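/- **Setting.** For $k\ge 1$ put $\rho(k)=\{2k-1,2k\}$. A partial bijection of $n$ is a bijection $\sigma:d\to d'$ where $d,d'\subseteq[2n]$ are unions of pairs $\rho(k)$ (the empty bijection is allowed); $Q_n$ is the set of these. The graph of $(\sigma,d,d')$ has vertex set $d$; $x\ne y$ are linked when they lie in the same pair, or when $\sigma(x),\sigma(y)$ lie in the same pair. It is a disjoint union of cycles of even lengths $2\lambda_1\ge 2\lambda_2\ge\cdots$, and $ct(\sigma)=(\lambda_1,\lambda_2,\dots)$ is the coset-type. A trivial extension of $(\sigma,d,d')$ is a partial bijection $(\tilde\sigma,\tilde d,\tilde d')$ of $n$ with $d\subseteq\tilde d$, $\tilde\sigma|_d=\sigma$ and $ct(\tilde\sigma)=ct(\sigma)\cup(1^{|\tilde d\setminus d|/2})$. On $\mathcal D_n=\mathbb C[Q_n]$ let $*$ be the bilinear product for which $\alpha_1*\alpha_2$ is the average of $\tilde\alpha_1\circ\tilde\alpha_2$ over all pairs of trivial extensions $\tilde\alpha_i$ of $\alpha_i$ in $Q_n$ such that the domain of $\tilde\alpha_1$ and the codomain of $\tilde\alpha_2$ are both equal to $d_1\cup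 d_2'$. Let $\mathcal B_n\subset\mathcal S_{2n}$ be the group of permutations that map pairs $\rho(k)$ to pairs. Let $\mathcal A_n$ be the space of elements of $\mathcal D_n$ invariant under $(a,b)\bullet(\sigma,d,d')=(a\sigma b^{-1},b(d),a(d'))$, $a,b\in\mathcal B_n$; it has the basis $S_{\lambda,n}=\sum_{ct(\alpha)=\lambda}\alpha$, $|\lambda|\le n$. Let $\varphi_n:\mathcal A_{n+1}\to\mathcal A_n$ be the linear map with $\varphi_n(S_{\lambda,n+1})=\frac{n+1}{n+1-|\lambda|}S_{\lambda,n}$ if $|\lambda|<n+1$ and $\varphi_n(S_{\lambda,n+1})=0$ if $|\lambda|=n+1$, and let $\mathcal A_\infty$ be the projective limit of $(\mathcal A_n,\varphi_n)$, with termwise operations. For every partition $\lambda$ (including the empty one) let $T_\lambda\in\mathcal A_\infty$ be the sequence with $n$-th term $\binom{n}{|\lambda|}^{-1}S_{\lambda,n}$ for $n\ge|\lambda|$ and $0$ for $n<|\lambda|$. Every element of $\mathcal A_\infty$ is a possibly infinite linear combination of the $T_\lambda$. Let $|\rho|$ be the size, $l(\rho)$ the number of parts and $m_1(\rho)$ the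 number of parts equal to $1$ of a partition $\rho$. **Proposition.** $\mathcal A_\infty$ is closed under $*$, and each of the three functions $$\deg_1(T_\rho)=|\rho|,\qquad \deg_2(T_\rho)=|\rho|-l(\rho),\qquad \deg_3(T_\rho)=|\rho|-l(\rho)+m_1(\rho)$$ defines an algebra filtration on $\mathcal A_\infty$. That is, for $i\in\{1,2,3\}$ and $k\ge 0$ let $F^{(i)}_k\subseteq\mathcal A_\infty$ be the subspace of all (possibly infinite) linear combinations of elements $T_\rho$ with $\deg_i(T_\rho)\le k$. Then: 1. $F^{(i)}_j\subseteq F^{(i)}_k$ for $j\le k$; 2. $F^{(i)}_j*F^{(i)}_k\subseteq F^{(i)}_{j+k}$ for all $j,k\ge 0$; 3. $T_\rho\in F^{(i)}_k$ if and only if $\deg_i(T_\rho)\le k$ (in particular $T_\emptyset\in F^{(i)}_0$); 4. every finite linear combination of the $T_\rho$ lies in $F^{(i)}_k$ for some $k$. -/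

import Mathlib

noncomputable section

namespace HeckeFiltration

/-! ### Partial bijections

The point `(k, false)` stands for the label `2k+1` and `(k, true)` for the label `2k+2`, so that the
fibre over `k < n` is the `(k+1)`-st pair `{2k+1, 2k+2}` and `{x | x.1 < n}` stands for `[2n]`. -/

/-- Labels, grouped in pairs. -/
abbrev Pt : Type := ℕ × Bool

/-- A partial bijection of `n`: a bijection from a union of pairs contained in `[2n]` onto a union of
pairs contained in `[2n]` (the empty bijection is included). -/
@[ext]
structure PBij (n : ℕ) where
  /-- The underlying bijection between the domain and the codomain. -/
  map : Pt ≃. Pt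
  dom_lt : ∀ x, (map x).isSome → x.1 < n
  cod_lt : ∀ y, (map.symm y).isSome → y.1 < n
  dom_pair : ∀ k b b', (map (k, b)).isSome → (map (k, b')).isSome
  cod_pair : ∀ k b b', (map.symm (k, b)).isSome → (map.symm (k, b')).isSome

namespace PBij

variable {n : ℕ}

/-- The domain. -/
def dom (α : PBij n) : Set Pt := {x | (α.map x).isSome}

/-- The codomain. -/
def cod (α : PBij n) : Set Pt := {y | (α.map.symm y).isSome}

/-- The image of a point of the domain. -/
def app (α : PBij n) (x : α.dom) : Pt := (α.map x.1).get x.2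

/-- The graph of a partial bijection: the vertices are the elements of the domain; two distinct
vertices are linked if they belong to the same pair (exterior edge), or if their images belong to the
same pair (interior edge). -/
def graph (α : PBij n) : SimpleGraph α.dom :=
  SimpleGraph.fromRel fun x y => x.1.1 = y.1.1 ∨ (α.app x).1 = (α.app y).1

theorem finite_dom (α : PBij n) : α.dom.Finite :=
  ((Set.finite_lt_nat n).prod (Set.finite_univ (α := Bool))).subset
    fun x hx => ⟨α.dom_lt x hx, trivial⟩

instance (α : PBij n) : Finite α.dom := α.finite_dom

instance (α : PBij n) : Finite α.graph.ConnectedComponent := Quot.finite _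

instance (α : PBij n) : Fintype α.graph.ConnectedComponent := Fintype.ofFinite _

/-- The coset-type: the multiset of the half-lengths of the cycles (connected components) of the
graph. -/
def cosetType (α : PBij n) : Multiset ℕ :=
  (Finset.univ : Finset α.graph.ConnectedComponent).val.map fun c => c.supp.ncard / 2

/-- `α'` is a trivial extension of `α`. -/
def IsTrivialExt (α α' : PBij n) : Prop :=
  α.map ≤ α'.map ∧
    α'.cosetType = α.cosetType + Multiset.replicate ((α'.dom \ α.dom).ncard / 2) 1

instance : Finite (PBij n) := by
  refine Finite.of_injective
    (β := Set ((Fin n × Bool) × (Fin n × Bool)))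
    (fun α => {p | α.map (p.1.1.val, p.1.2) = some (p.2.1.val, p.2.2)}) ?_
  intro α β h
  have key : ∀ (γ δ : PBij n),
      ({p | γ.map (p.1.1.val, p.1.2) = some (p.2.1.val, p.2.2)} :
        Set ((Fin n × Bool) × (Fin n × Bool))) =
        {p | δ.map (p.1.1.val, p.1.2) = some (p.2.1.val, p.2.2)} →
      ∀ x y, γ.map x = some y → δ.map x = some y := by
    intro γ δ hs x y hxy
    have hx : x.1 < n := γ.dom_lt x (by simp [hxy])
    have hy : y.1 < n := γ.cod_lt y (by simp [(γ.map.eq_some_iff).2 hxy])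
    have := (Set.ext_iff.1 hs ((⟨x.1, hx⟩, x.2), (⟨y.1, hy⟩, y.2))).1 hxy
    simpa using this
  apply PBij.ext
  apply PEquiv.ext
  intro x
  apply Option.ext
  intro y
  exact ⟨key α β h x y, key β α h.symm x y⟩

instance : Fintype (PBij n) := Fintype.ofFinite _

/-- Pairs `(α₁, α₂)` for which the composition `α₁ ∘ α₂` makes sense: the domain of `α₁` is the
codomain of `α₂`. -/
abbrev Composable (n : ℕ) : Type := {p : PBij n × PBij n // p.1.dom = p.2.cod}

instance : Fintype (Composable n) := Fintype.ofFinite _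

theorem isSome_trans_iff {f g : Pt ≃. Pt} (h : ∀ y, (g y).isSome ↔ (f.symm y).isSome) (x : Pt) :
    ((f.trans g) x).isSome ↔ (f x).isSome := by
  constructor
  · intro hx
    obtain ⟨z, hz⟩ := Option.isSome_iff_exists.1 hx
    obtain ⟨y, hy, -⟩ := (PEquiv.trans_eq_some f g x z).1 hz
    simp [hy]
  · intro hx
    obtain ⟨y, hy⟩ := Option.isSome_iff_exists.1 hx
    have hgy : (g y).isSome := (h y).2 (by simp [(f.eq_some_iff).2 hy])
    obtain ⟨z, hz⟩ := Option.isSome_iff_exists.1 hgy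
    exact Option.isSome_iff_exists.2 ⟨z, (PEquiv.trans_eq_some f g x z).2 ⟨y, hy, hz⟩⟩

/-- The composition `α₁ ∘ α₂` (first `α₂`, then `α₁`). -/
def comp (p : Composable n) : PBij n :=
  have h : ∀ y, (p.1.1.map y).isSome ↔ (p.1.2.map.symm y).isSome := fun y => Set.ext_iff.1 p.2 y
  have hd := isSome_trans_iff (f := p.1.2.map) (g := p.1.1.map) h
  have hc := isSome_trans_iff (f := p.1.1.map.symm) (g := p.1.2.map.symm) fun y => (h y).symm
  { map := p.1.2.map.trans p.1.1.map
    dom_lt := fun x hx => p.1.2.dom_lt x ((hd x).1 hx)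
    cod_lt := fun y hy => p.1.1.cod_lt y ((hc y).1 hy)
    dom_pair := fun k b b' hx => (hd _).2 (p.1.2.dom_pair k b b' ((hd _).1 hx))
    cod_pair := fun k b b' hy => (hc _).2 (p.1.1.cod_pair k b b' ((hc _).1 hy)) }

open Classical in
/-- The pairs of trivial extensions of `α₁`, `α₂` such that the domain of the first and the codomain
of the second are both equal to `d₁ ∪ d₂'`. -/
def E (α₁ α₂ : PBij n) : Finset (Composable n) :=
  Finset.univ.filter fun p =>
    α₁.IsTrivialExt p.1.1 ∧ α₂.IsTrivialExt p.1.2 ∧ p.1.1.dom = α₁.dom ∪ α₂.cod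

/-- A partial bijection of `n` seen as a partial bijection of `n + 1`. -/
def up (α : PBij n) : PBij (n + 1) where
  map := α.map
  dom_lt x hx := (α.dom_lt x hx).trans n.lt_succ_self
  cod_lt x hx := (α.cod_lt x hx).trans n.lt_succ_self
  dom_pair := α.dom_pair
  cod_pair := α.cod_pair

theorem cosetType_up (α : PBij n) : α.up.cosetType = α.cosetType := rfl

end PBij

/-! ### The partial bijection algebra -/

/-- The complex vector space with basis the partial bijections of `n`. -/
def PBAlg (n : ℕ) : Type := PBij n →₀ ℂ

instance (n : ℕ) : AddCommGroup (PBAlg n) := inferInstanceAs (AddCommGroup (PBij n →₀ ℂ))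

instance (n : ℕ) : Module ℂ (PBAlg n) := inferInstanceAs (Module ℂ (PBij n →₀ ℂ))

variable {n : ℕ}

/-- The basis vector of a partial bijection. -/
def basisVec (α : PBij n) : PBAlg n := Finsupp.single α 1

/-- The coefficient of a partial bijection. -/
def coeff (x : PBAlg n) (α : PBij n) : ℂ := (show PBij n →₀ ℂ from x) α

/-- The product of two partial bijections: the average of the compositions of the pairs of trivial
extensions in `E`. -/
def starBasis (α₁ α₂ : PBij n) : PBAlg n :=
  ((PBij.E α₁ α₂).card : ℂ)⁻¹ • ∑ p ∈ PBij.E α₁ α₂, basisVec (PBij.comp p)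

@[simp]
theorem coeff_zero (α : PBij n) : coeff (0 : PBAlg n) α = 0 := rfl

@[simp]
theorem coeff_add (x y : PBAlg n) (α : PBij n) : coeff (x + y) α = coeff x α + coeff y α := rfl

@[simp]
theorem coeff_smul (c : ℂ) (x : PBAlg n) (α : PBij n) : coeff (c • x) α = c * coeff x α := rfl

open Classical in
theorem coeff_basisVec (α β : PBij n) : coeff (basisVec α) β = if α = β then 1 else 0 :=
  Finsupp.single_apply

/-- The product of the partial bijection algebra: the bilinear extension of the product of partial
bijections. -/
instance (n : ℕ) : Mul (PBAlg n) where
  mul x y := ∑ α₁ : PBij n, ∑ α₂ : PBij n, (coeff x α₁ * coeff y α₂) • starBasis α₁ α₂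

theorem mul_def (x y : PBAlg n) :
    x * y = ∑ α₁ : PBij n, ∑ α₂ : PBij n, (coeff x α₁ * coeff y α₂) • starBasis α₁ α₂ := rfl

instance (n : ℕ) : NonUnitalNonAssocRing (PBAlg n) where
  left_distrib x y z := by
    simp only [mul_def, coeff_add, mul_add, add_smul, Finset.sum_add_distrib]
  right_distrib x y z := by
    simp only [mul_def, coeff_add, add_mul, add_smul, Finset.sum_add_distrib]
  zero_mul x := by simp [mul_def]
  mul_zero x := by simp [mul_def]

theorem basisVec_mul_basisVec (α₁ α₂ : PBij n) :
    basisVec α₁ * basisVec α₂ = starBasis α₁ α₂ := by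
  classical
  simp [mul_def, coeff_basisVec, ite_smul]

theorem smul_mul_smul (c d : ℂ) (x y : PBAlg n) : (c • x) * (d • y) = (c * d) • (x * y) := by
  simp only [mul_def, coeff_smul, Finset.smul_sum, smul_smul]
  refine Finset.sum_congr rfl fun α _ => Finset.sum_congr rfl fun β _ => ?_
  congr 1
  ring

/-! ### Invariants under the hyperoctahedral group -/

/-- The hyperoctahedral group: permutations of `[2n]` (extended by the identity) that map pairs onto
pairs. -/
def hyperoctahedral (n : ℕ) : Subgroup (Equiv.Perm Pt) where
  carrier := {w | (∀ x : Pt, n ≤ x.1 → w x = x) ∧ ∀ k b b', (w (k, b)).1 = (w (k, b')).1}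
  one_mem' := by simp
  mul_mem' := by
    rintro u v ⟨hu, hu'⟩ ⟨hv, hv'⟩
    refine ⟨fun x hx => by simp [hv x hx, hu x hx], fun k b b' => ?_⟩
    have h := hv' k b b'
    simp only [Equiv.Perm.mul_apply]
    rw [← Prod.mk.eta (p := v (k, b)), ← Prod.mk.eta (p := v (k, b')), h]
    exact hu' _ _ _
  inv_mem' := by
    rintro w ⟨hw, hw'⟩
    refine ⟨fun x hx => ?_, fun k b b' => ?_⟩
    · rw [Equiv.Perm.inv_eq_iff_eq, hw x hx]
    · by_cases hb : b = b'
      · rw [hb]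
      · set x := w⁻¹ (k, b) with hx
        have hwx : w x = (k, b) := by simp [hx]
        have h1 : (w (x.1, !x.2)).1 = k := by
          rw [hw' x.1 (!x.2) x.2, Prod.mk.eta, hwx]
        have h2 : w (x.1, !x.2) = (k, b') := by
          have h3 : w (x.1, !x.2) ≠ (k, b) := by
            rw [← hwx]
            intro h
            have := congrArg Prod.snd (w.injective h)
            simp at this
          refine Prod.ext h1 ?_
          have h4 : (w (x.1, !x.2)).2 ≠ b := fun h => h3 (Prod.ext h1 h)
          change (w (x.1, !x.2)).2 = b'
          revert h4 hb
          generalize (w (x.1, !x.2)).2 = c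
          cases b <;> cases b' <;> cases c <;> simp
        have h5 : w⁻¹ (k, b') = (x.1, !x.2) := by rw [← h2]; simp
        rw [h5]

theorem act_dom_aux {b : Equiv.Perm Pt} (hb : b ∈ hyperoctahedral n) {P : Pt → Prop}
    (hlt : ∀ x, P x → x.1 < n) (hpair : ∀ k c c', P (k, c) → P (k, c')) :
    (∀ x, P (b⁻¹ x) → x.1 < n) ∧ ∀ k c c', P (b⁻¹ (k, c)) → P (b⁻¹ (k, c')) := by
  have hb' := inv_mem hb
  refine ⟨fun x hx => ?_, fun k c c' h => ?_⟩
  · by_contra hn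
    have h := hlt _ hx
    rw [hb'.1 x (not_lt.1 hn)] at h
    exact hn h
  · rw [← Prod.mk.eta (p := b⁻¹ (k, c'))]
    rw [← Prod.mk.eta (p := b⁻¹ (k, c)), hb'.2 k c c'] at h
    exact hpair _ _ _ h

theorem isSome_conj (f : Pt ≃. Pt) (a b : Equiv.Perm Pt) (x : Pt) :
    (((b⁻¹).toPEquiv.trans (f.trans a.toPEquiv)) x).isSome ↔ (f (b⁻¹ x)).isSome := by
  simp only [Option.isSome_iff_exists, PEquiv.trans_eq_some, Equiv.toPEquiv_apply,
    Option.some.injEq]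
  constructor
  · rintro ⟨z, y, rfl, w, hw, -⟩
    exact ⟨w, hw⟩
  · rintro ⟨w, hw⟩
    exact ⟨a w, _, rfl, w, hw, rfl⟩

/-- The action of a pair `(a, b)` of elements of the hyperoctahedral group on partial bijections:
`(σ, d, d')` is sent to `(a σ b⁻¹, b(d), a(d'))`. -/
def act (a b : hyperoctahedral n) (α : PBij n) : PBij n :=
  have hd := isSome_conj α.map a.1 b.1
  have hc : ∀ y, (((b.1⁻¹).toPEquiv.trans (α.map.trans a.1.toPEquiv)).symm y).isSome ↔
      (α.map.symm (a.1⁻¹ y)).isSome := by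
    intro y
    have := isSome_conj α.map.symm b.1 a.1 y
    rw [← this]
    simp only [PEquiv.symm_trans_rev, ← Equiv.toPEquiv_symm, PEquiv.trans_assoc]
    rfl
  have h1 := act_dom_aux b.2 (P := fun x => (α.map x).isSome) α.dom_lt α.dom_pair
  have h2 := act_dom_aux a.2 (P := fun x => (α.map.symm x).isSome) α.cod_lt α.cod_pair
  { map := (b.1⁻¹).toPEquiv.trans (α.map.trans a.1.toPEquiv)
    dom_lt := fun x hx => h1.1 x ((hd x).1 hx)
    cod_lt := fun y hy => h2.1 y ((hc y).1 hy)
    dom_pair := fun k c c' h => (hd _).2 (h1.2 k c c' ((hd _).1 h))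
    cod_pair := fun k c c' h => (hc _).2 (h2.2 k c c' ((hc _).1 h)) }

/-- The linear extension of the action. -/
def actLin (a b : hyperoctahedral n) : PBAlg n →ₗ[ℂ] PBAlg n where
  toFun x := ∑ α : PBij n, coeff x α • basisVec (act a b α)
  map_add' x y := by simp only [coeff_add, add_smul, Finset.sum_add_distrib]
  map_smul' c x := by
    simp only [coeff_smul, RingHom.id_apply, Finset.smul_sum, smul_smul]

/-- The space `𝒜ₙ` of elements invariant under the action. -/
def AInv (n : ℕ) : Submodule ℂ (PBAlg n) where
  carrier := {x | ∀ a b : hyperoctahedral n, actLin a b x = x}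
  add_mem' hx hy a b := by rw [map_add, hx a b, hy a b]
  zero_mem' a b := map_zero _
  smul_mem' c x hx a b := by rw [map_smul, hx a b]

/-- Partitions of arbitrary size. The size of `r` is `r.1`, its multiset of parts is `r.2.parts`. -/
abbrev Ptn : Type := Σ m : ℕ, Nat.Partition m

open Classical in
/-- The sum `S_{r, n}` of all partial bijections of `n` with coset-type `r`. -/
def S (r : Ptn) (n : ℕ) : PBAlg n :=
  ∑ α ∈ (Finset.univ : Finset (PBij n)).filter (fun α => α.cosetType = r.2.parts), basisVec α

/-! ### The projective limit -/

/-- The linear map that multiplies the coefficient of a partial bijection `α` of `n` with coset-type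
`r` by `(n+1)/(n+1-|r|)` and forgets the partial bijections of `n+1` that are not partial bijections
of `n`. By `phi_S` below it sends `S_{r, n+1}` to `(n+1)/(n+1-|r|) S_{r, n}` if `|r| < n+1`, and
to `0` if `|r| = n+1`; since the `S_{r, n+1}` span `𝒜ₙ₊₁`, its restriction to `𝒜ₙ₊₁` is the map
`φₙ` given by these formulas. -/
def phi (n : ℕ) : PBAlg (n + 1) →ₗ[ℂ] PBAlg n where
  toFun x := ∑ α : PBij n,
    (((n : ℂ) + 1) / ((n : ℂ) + 1 - (α.cosetType.sum : ℕ)) * coeff x α.up) • basisVec α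
  map_add' x y := by
    rw [← Finset.sum_add_distrib]
    refine Finset.sum_congr rfl fun α _ => ?_
    rw [← add_smul, ← mul_add]
    rfl
  map_smul' c x := by
    rw [RingHom.id_apply, Finset.smul_sum]
    refine Finset.sum_congr rfl fun α _ => ?_
    rw [smul_smul, mul_left_comm]
    rfl

open Classical in
theorem coeff_S (r : Ptn) (n : ℕ) (α : PBij n) :
    coeff (S r n) α = if α.cosetType = r.2.parts then 1 else 0 := by
  have : coeff (S r n) α =
      ∑ β ∈ (Finset.univ : Finset (PBij n)).filter (fun β => β.cosetType = r.2.parts),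
        coeff (basisVec β) α :=
    map_sum (Finsupp.applyAddHom α : (PBij n →₀ ℂ) →+ ℂ) (fun β => Finsupp.single β 1) _
  rw [this]
  simp [coeff, basisVec, Finsupp.single_apply, Finset.sum_ite_eq']

theorem phi_S (r : Ptn) (n : ℕ) (hr : r.1 ≤ n + 1) :
    phi n (S r (n + 1)) =
      if r.1 < n + 1 then (((n : ℂ) + 1) / ((n : ℂ) + 1 - r.1)) • S r n else 0 := by
  classical
  have h : phi n (S r (n + 1)) = (((n : ℂ) + 1) / ((n : ℂ) + 1 - r.1)) • S r n := by
    change ∑ α : PBij n, (((n : ℂ) + 1) / ((n : ℂ) + 1 - (α.cosetType.sum : ℕ)) *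
      coeff (S r (n + 1)) α.up) • basisVec α = _
    rw [S.eq_def r n, Finset.smul_sum, Finset.sum_filter]
    refine Finset.sum_congr rfl fun α _ => ?_
    rw [coeff_S, PBij.cosetType_up]
    split_ifs with h
    · rw [h, r.2.parts_sum, mul_one]
    · rw [mul_zero, zero_smul]
  rw [h]
  split_ifs with h1
  · rfl
  · rw [le_antisymm hr (not_lt.1 h1)]
    simp

/-- Sequences `(aₙ)` with `aₙ` in the `n`-th partial bijection algebra; sum, scalar multiplication
and product are termwise. -/
abbrev Seq : Type := ∀ n : ℕ, PBAlg n

/-- The projective limit `𝒜_∞` of `(𝒜ₙ, φₙ)`, with termwise product. The term of index `0` is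
`φ₀(a₁)`, so that allowing `n = 0` does not change the limit. -/
def AInfty : Submodule ℂ Seq where
  carrier := {a | (∀ n, a n ∈ AInv n) ∧ ∀ n, phi n (a (n + 1)) = a n}
  add_mem' ha hb := ⟨fun n => add_mem (ha.1 n) (hb.1 n), fun n => by
    rw [Pi.add_apply, map_add, ha.2 n, hb.2 n]; rfl⟩
  zero_mem' := ⟨fun n => zero_mem _, fun n => map_zero _⟩
  smul_mem' c a ha := ⟨fun n => (AInv n).smul_mem c (ha.1 n), fun n => by
    rw [Pi.smul_apply, map_smul, ha.2 n]; rfl⟩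

/-- The element `T_r` of `𝒜_∞`. -/
def T (r : Ptn) : Seq := fun n => if n < r.1 then 0 else ((n.choose r.1 : ℂ)⁻¹) • S r n

/-- The infinite linear combination `∑ x_r T_r` over all partitions `r`. Its `n`-th term is a finite
sum, because the `n`-th term of `T_r` vanishes for `|r| > n`. -/
def infComb (x : Ptn → ℂ) : Seq := fun n =>
  ∑ m ∈ Finset.range (n + 1), ∑ p : Nat.Partition m, x ⟨m, p⟩ • T ⟨m, p⟩ n

/-- The finite linear combinations of the `T_r`. -/
def AFin : Submodule ℂ Seq := Submodule.span ℂ (Set.range T)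

/-! ### Filtrations -/

/-- The subspace of the elements of `𝒜_∞` that are (possibly infinite) linear combinations of
elements `T_r` with `d r ≤ k`. -/
def filt (d : Ptn → ℕ) (k : ℕ) : Submodule ℂ Seq where
  carrier := {a | a ∈ AInfty ∧ ∃ x : Ptn → ℂ, a = infComb x ∧ ∀ r, x r ≠ 0 → d r ≤ k}
  add_mem' := by
    rintro a b ⟨ha, x, rfl, hx⟩ ⟨hb, y, rfl, hy⟩
    refine ⟨add_mem ha hb, x + y, ?_, fun r hr => ?_⟩
    · funext n
      simp only [infComb, Pi.add_apply, add_smul, Finset.sum_add_distrib]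
    · by_cases h : x r = 0
      · exact hy r fun h' => hr (by simp [h, h'])
      · exact hx r h
  zero_mem' := ⟨zero_mem _, 0, by funext n; simp [infComb], fun r hr => absurd rfl hr⟩
  smul_mem' := by
    rintro c a ⟨ha, x, rfl, hx⟩
    refine ⟨AInfty.smul_mem c ha, c • x, ?_, fun r hr => hx r fun h => hr (by simp [h])⟩
    funext n
    simp only [infComb, Pi.smul_apply, Finset.smul_sum, smul_smul, smul_eq_mul]

/-- The function `T_r ↦ d r` defines an algebra filtration on `𝒜_∞`: the subspaces `filt d k` form
an increasing sequence, the product of an element of `filt d j` and an element of `filt d k` is in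
`filt d (j + k)`, the filtration degree of `T_r` is `d r`, and every finite linear combination of
the `T_r` has finite degree. -/
structure DefinesFiltration (d : Ptn → ℕ) : Prop where
  mono : Monotone (filt d)
  mul_mem : ∀ j k a b, a ∈ filt d j → b ∈ filt d k → a * b ∈ filt d (j + k)
  T_mem_iff : ∀ r k, T r ∈ filt d k ↔ d r ≤ k
  exhaustive : ∀ a ∈ AFin, ∃ k, a ∈ filt d k

/-- `|r|` -/
def deg₁ (r : Ptn) : ℕ := r.1

/-- `|r| - l(r)`; the subtraction does not truncate, because a partition of `m` has at most `m`
parts. -/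
def deg₂ (r : Ptn) : ℕ := r.1 - Multiset.card r.2.parts

/-- `|r| - l(r) + m₁(r)` -/
def deg₃ (r : Ptn) : ℕ := r.1 - Multiset.card r.2.parts + r.2.parts.count 1

end HeckeFiltration

end

/-! Three pairings on one set control everything. For extensions that can be composed, let X be the
domain of the second factor. A point of X has three labels: the index of its own pair (`outer`), of
the pair of its image (`inner`), and of the pair of its image under the composition (`final`). Each
label has classes of size two. The coset-types of the second factor, of the first factor and of the
composition are the cycle types of the graphs of (outer, inner), (inner, final) and (outer, final).

Let N be the number of pairs and c₀₁, c₁₂, c₀₂ the numbers of components of these graphs. Then N - c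
is |ρ| - l(ρ), which a trivial extension does not change, since it only adds parts 1. The central
inequality is c₀₁ + c₁₂ + s ≤ N + c₀₂ (`card_components_add_le`), where s counts the two-element
components of (outer, final) that are not classes of `inner`. It comes from an injective linear map
between spaces of functions. Dropping s gives the bound for deg₂. For deg₃, a part 1 of the
composition is either counted by s or is a class of all three pairings. In the latter case its
middle pair lies in d₁ ∪ d₂', and so is already a part 1 of one of the two original factors
(`ncard_common_le`). Hence the parts 1 that are newly created are paid for by s
(`exists_degree_correction`). The bound for deg₁ is |d₁ ∪ d₂'| ≤ |d₁| + |d₂'|.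

Closure under the product means that φₙ is multiplicative on invariants (`phi_mul`). A coefficient
of a product is a sum over triples (two factors and a composable pair of extensions), weighted by
the inverse of the number of such pairs. Passing from n + 1 to n changes that number (`card_E_up`)
and discards the triples whose middle set contains the last pair (`sum_weight_eq`). Both effects are
computed by exchanging the last pair with another one, and together they match the factors in φₙ.

Finally, two partial bijections with the same coset-type lie in one orbit
(`PBij.exists_act_of_cosetType_eq`), because graphs of two pairings with equal cycle types are
isomorphic. So an element of the limit is an infinite combination of the T_r, and the coefficient of
T_r can be read at a single partial bijection of |r| with coset-type r (`eq_infComb`). A filtration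
bound then needs to be checked only on individual compositions (`definesFiltration`). -/

noncomputable section

namespace HeckeFiltration

/-! ### Graphs of two pairings -/

section Pairing

variable {X Y : Type*}

/-- All fibres of the labelling `π` have exactly two elements. -/
def IsPairing (π : X → ℕ) : Prop := ∀ x, ∃ y, y ≠ x ∧ ∀ z, π z = π x ↔ z = x ∨ z = y

theorem IsPairing.comp {π : Y → ℕ} (h : IsPairing π) (e : X ≃ Y) : IsPairing (π ∘ e) := by
  intro x
  obtain ⟨y, hy, hz⟩ := h (e x)
  refine ⟨e.symm y, fun h' => hy (by rw [← h', Equiv.apply_symm_apply]), fun z => ?_⟩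
  simp only [Function.comp_apply, hz, EmbeddingLike.apply_eq_iff_eq, Equiv.eq_symm_apply]

/-- The other element with the same label. -/
def IsPairing.partnerFun {π : X → ℕ} (h : IsPairing π) (x : X) : X := (h x).choose

theorem IsPairing.label_eq_iff' {π : X → ℕ} (h : IsPairing π) (x z : X) :
    π z = π x ↔ z = x ∨ z = h.partnerFun x := (h x).choose_spec.2 z

theorem IsPairing.partnerFun_partnerFun {π : X → ℕ} (h : IsPairing π) (x : X) :
    h.partnerFun (h.partnerFun x) = x := by
  have h1 : π (h.partnerFun x) = π x := (h.label_eq_iff' x _).2 (Or.inr rfl)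
  rcases (h.label_eq_iff' _ x).1 h1.symm with h2 | h2
  · exact absurd h2.symm (h x).choose_spec.1
  · exact h2.symm

/-- The fixed point free involution attached to a pairing. -/
def IsPairing.partner {π : X → ℕ} (h : IsPairing π) : Equiv.Perm X :=
  (show Function.Involutive h.partnerFun from h.partnerFun_partnerFun).toPerm

theorem IsPairing.partner_partner {π : X → ℕ} (h : IsPairing π) (x : X) :
    h.partner (h.partner x) = x := h.partnerFun_partnerFun x

theorem IsPairing.partner_ne {π : X → ℕ} (h : IsPairing π) (x : X) : h.partner x ≠ x :=
  (h x).choose_spec.1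

theorem IsPairing.label_eq_iff {π : X → ℕ} (h : IsPairing π) {x z : X} :
    π z = π x ↔ z = x ∨ z = h.partner x := h.label_eq_iff' x z

theorem IsPairing.label_partner {π : X → ℕ} (h : IsPairing π) (x : X) :
    π (h.partner x) = π x := h.label_eq_iff.2 (Or.inr rfl)

/-- The graph in which two elements are linked if they share one of their two labels. -/
def pairGraph (π π' : X → ℕ) : SimpleGraph X :=
  SimpleGraph.fromRel fun x y => π x = π y ∨ π' x = π' y

theorem pairGraph_adj {π π' : X → ℕ} {x y : X} :
    (pairGraph π π').Adj x y ↔ x ≠ y ∧ (π x = π y ∨ π' x = π' y) := by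
  rw [pairGraph, SimpleGraph.fromRel_adj]
  grind

theorem pairGraph_comm (π π' : X → ℕ) : pairGraph π π' = pairGraph π' π := by
  ext x y
  simp only [pairGraph_adj, or_comm]

theorem reachable_of_left {π π' : X → ℕ} {x y : X} (h : π x = π y) :
    (pairGraph π π').Reachable x y := by
  by_cases hxy : x = y
  · exact hxy ▸ SimpleGraph.Reachable.refl _
  · exact (pairGraph_adj.2 ⟨hxy, Or.inl h⟩).reachable

theorem reachable_of_right {π π' : X → ℕ} {x y : X} (h : π' x = π' y) :
    (pairGraph π π').Reachable x y := by
  by_cases hxy : x = y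
  · exact hxy ▸ SimpleGraph.Reachable.refl _
  · exact (pairGraph_adj.2 ⟨hxy, Or.inr h⟩).reachable

/-- Induction along a connected component. -/
theorem Reachable.induction {π π' : X → ℕ} {P : X → Prop} {x y : X}
    (h : (pairGraph π π').Reachable x y) (hx : P x)
    (h1 : ∀ u v, P u → π u = π v → P v) (h2 : ∀ u v, P u → π' u = π' v → P v) : P y := by
  rw [SimpleGraph.reachable_iff_reflTransGen] at h
  induction h with
  | refl => exact hx
  | tail _ hadj ih =>
    rcases (pairGraph_adj.1 hadj).2 with h | h
    · exact h1 _ _ ih h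
    · exact h2 _ _ ih h

/-- Half of the number of vertices of a connected component. -/
def halfSize {π π' : X → ℕ} (c : (pairGraph π π').ConnectedComponent) : ℕ := c.supp.ncard / 2

instance [Finite X] (G : SimpleGraph X) : Fintype G.ConnectedComponent := 
  @Fintype.ofFinite _ (Quot.finite _)

/-- The multiset of the half-sizes of the connected components of the graph of two pairings. -/
def cycleType [Finite X] (π π' : X → ℕ) : Multiset ℕ :=
  (Finset.univ : Finset (pairGraph π π').ConnectedComponent).val.map halfSize

theorem cycleType_comm [Finite X] (π π' : X → ℕ) : cycleType π π' = cycleType π' π := by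
  unfold cycleType halfSize
  rw [pairGraph_comm]

/-- Only the classes of the two labellings matter, not the values of the labels, so a bijection that
preserves both families of classes is an isomorphism of the graphs. -/
theorem cycleType_congr [Finite X] [Finite Y] {π π' : X → ℕ} {τ τ' : Y → ℕ} (e : X ≃ Y)
    (h : ∀ x y, π x = π y ↔ τ (e x) = τ (e y))
    (h' : ∀ x y, π' x = π' y ↔ τ' (e x) = τ' (e y)) : cycleType π π' = cycleType τ τ' := by
  have hadj : ∀ x y, (pairGraph τ τ').Adj (e x) (e y) ↔ (pairGraph π π').Adj x y := by
    simp [pairGraph_adj, h, h']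
  let φ : pairGraph π π' ≃g pairGraph τ τ' := ⟨e, hadj _ _⟩
  unfold cycleType
  rw [← Finset.map_univ_equiv φ.connectedComponentEquiv, Finset.map_val, Multiset.map_map]
  refine Multiset.map_congr rfl fun c _ => ?_
  unfold halfSize
  congr 1
  exact Nat.card_congr (c.isoEquivSupp φ)

/-! ### Structure of the components -/

/-- The bi-infinite alternating path through `x` of two involutions. -/
def altPath (a b : Equiv.Perm X) (x : X) (u : ℤ × Bool) : X :=
  bif u.2 then b (((a * b) ^ u.1) x) else ((a * b) ^ u.1) x

variable {a b : Equiv.Perm X}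

/-- Conjugation by `b` sends `a * b` to `b * a`, which is its inverse. -/
theorem involution_zpow (ha : ∀ x, a (a x) = x) (hb : ∀ x, b (b x) = x) (k : ℤ) (x : X) :
    b (((a * b) ^ k) x) = ((a * b) ^ (-k)) (b x) := by
  have ha' : a * a = 1 := Equiv.ext ha
  have hb' : b * b = 1 := Equiv.ext hb
  have h : SemiconjBy b (a * b) (a * b)⁻¹ := by
    rw [SemiconjBy, mul_inv_rev, mul_eq_one_iff_inv_eq.1 ha', mul_eq_one_iff_inv_eq.1 hb']
    group
  have h2 := (h.zpow_right k).eq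
  rw [inv_zpow'] at h2
  exact Equiv.congr_fun h2 x

/-- An equality would make `b (ab)^k` fix `x` for some `k`. This word is conjugate to `b` when `k`
is even and to `a` when `k` is odd, and neither involution has a fixed point. -/
theorem altPath_false_ne_true (ha : ∀ x, a (a x) = x) (hb : ∀ x, b (b x) = x)
    (ha' : ∀ x, a x ≠ x) (hb' : ∀ x, b x ≠ x) (x : X) (i j : ℤ) :
    ((a * b) ^ i) x ≠ b (((a * b) ^ j) x) := by
  intro h
  have key : ∀ k : ℤ, b (((a * b) ^ k) x) ≠ x := by
    intro k hk
    obtain ⟨l, rfl | rfl⟩ := Int.even_or_odd' k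
    · rw [two_mul, zpow_add, Equiv.Perm.mul_apply, involution_zpow ha hb, zpow_neg,
        Equiv.Perm.inv_eq_iff_eq] at hk
      exact hb' _ hk
    · rw [show (2 * l + 1 : ℤ) = (l + 1) + l by ring, zpow_add, Equiv.Perm.mul_apply,
        involution_zpow ha hb, zpow_neg, Equiv.Perm.inv_eq_iff_eq, add_comm, zpow_add, zpow_one,
        Equiv.Perm.mul_apply, Equiv.Perm.mul_apply] at hk
      exact ha' _ hk.symm
  apply key (i + j)
  rw [zpow_add, Equiv.Perm.mul_apply, involution_zpow ha hb, ← h, ← Equiv.Perm.mul_apply,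
    ← zpow_add]
  simp

theorem altPath_eq_iff (ha : ∀ x, a (a x) = x) (hb : ∀ x, b (b x) = x)
    (ha' : ∀ x, a x ≠ x) (hb' : ∀ x, b x ≠ x) (x : X) (u v : ℤ × Bool) :
    altPath a b x u = altPath a b x v ↔
      u.2 = v.2 ∧ (MulAction.period (a * b) x : ℤ) ∣ u.1 - v.1 := by
  have h0 : ∀ i j : ℤ, ((a * b) ^ i) x = ((a * b) ^ j) x ↔
      (MulAction.period (a * b) x : ℤ) ∣ i - j := by
    intro i j
    rw [← MulAction.zpow_smul_eq_iff_period_dvd, sub_eq_neg_add, zpow_add, zpow_neg,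
      Equiv.Perm.smul_def, Equiv.Perm.mul_apply, Equiv.Perm.inv_eq_iff_eq]
  obtain ⟨i, _ | _⟩ := u <;> obtain ⟨j, _ | _⟩ := v
  · simp [altPath, h0]
  · simpa [altPath] using altPath_false_ne_true ha hb ha' hb' x i j
  · simpa [altPath] using (altPath_false_ne_true ha hb ha' hb' x j i).symm
  · simp [altPath, h0]

theorem apply_left_altPath (ha : ∀ x, a (a x) = x) (x : X) (u : ℤ × Bool) :
    a (altPath a b x u) = altPath a b x (bif u.2 then (u.1 + 1, false) else (u.1 - 1, true)) := by
  obtain ⟨i, _ | _⟩ := u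
  · simp only [altPath, cond_false, cond_true]
    conv_lhs => rw [show i = 1 + (i - 1) by ring, zpow_add, zpow_one, Equiv.Perm.mul_apply,
      Equiv.Perm.mul_apply, ha]
  · simp only [altPath, cond_false, cond_true]
    rw [add_comm, zpow_add, zpow_one, Equiv.Perm.mul_apply, Equiv.Perm.mul_apply]

theorem apply_right_altPath (hb : ∀ x, b (b x) = x) (x : X) (u : ℤ × Bool) :
    b (altPath a b x u) = altPath a b x (u.1, !u.2) := by
  obtain ⟨i, _ | _⟩ := u
  · simp [altPath]
  · simp [altPath, hb]

theorem altPath_zero (x : X) : altPath a b x (0, false) = x := by simp [altPath]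

section

variable {π π' : X → ℕ} (h : IsPairing π) (h' : IsPairing π')

/-- The path alternates: `π'` links `(i, false)` to `(i, true)`, and `π` links `(i, true)` to `(i +
1, false)`. -/
theorem IsPairing.reachable_altPath (x : X) (u : ℤ × Bool) :
    (pairGraph π π').Reachable x (altPath h.partner h'.partner x u) := by
  have hb : ∀ i : ℤ, (pairGraph π π').Reachable (altPath h.partner h'.partner x (i, false))
      (altPath h.partner h'.partner x (i, true)) := fun i => by
    refine reachable_of_right ?_
    rw [← h'.label_partner, apply_right_altPath h'.partner_partner]
    rfl
  have ha : ∀ i : ℤ, (pairGraph π π').Reachable (altPath h.partner h'.partner x (i, true))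
      (altPath h.partner h'.partner x (i + 1, false)) := fun i => by
    refine reachable_of_left ?_
    rw [← h.label_partner, apply_left_altPath h.partner_partner]
    rfl
  have hf : ∀ i : ℤ, (pairGraph π π').Reachable x
      (altPath h.partner h'.partner x (i, false)) := by
    intro i
    induction i using Int.induction_on with
    | zero => rw [altPath_zero]
    | succ i ih => exact ih.trans ((hb _).trans (ha _))
    | pred i ih =>
      refine ih.trans ?_
      have := (hb (-i - 1)).trans (ha (-i - 1))
      rw [sub_add_cancel] at this
      exact this.symm
  obtain ⟨i, _ | _⟩ := u
  · exact hf i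
  · exact (hf i).trans (hb i)

theorem IsPairing.exists_altPath_eq {x y : X} (hxy : (pairGraph π π').Reachable x y) :
    ∃ u, altPath h.partner h'.partner x u = y := by
  refine Reachable.induction (P := fun y => ∃ u, altPath h.partner h'.partner x u = y) hxy
    ⟨(0, false), altPath_zero x⟩ ?_ ?_
  · rintro _ v ⟨u, rfl⟩ hv
    rcases h.label_eq_iff.1 hv.symm with rfl | rfl
    · exact ⟨_, rfl⟩
    · exact ⟨_, (apply_left_altPath h.partner_partner _ _).symm⟩
  · rintro _ v ⟨u, rfl⟩ hv
    rcases h'.label_eq_iff.1 hv.symm with rfl | rfl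
    · exact ⟨_, rfl⟩
    · exact ⟨_, (apply_right_altPath h'.partner_partner _ _).symm⟩

theorem IsPairing.altPath_eq_iff (x : X) (u v : ℤ × Bool) :
    altPath h.partner h'.partner x u = altPath h.partner h'.partner x v ↔
      u.2 = v.2 ∧ (MulAction.period (h.partner * h'.partner) x : ℤ) ∣ u.1 - v.1 :=
  HeckeFiltration.altPath_eq_iff h.partner_partner h'.partner_partner h.partner_ne
    h'.partner_ne x u v

theorem IsPairing.period_pos [Finite X] (x : X) :
    0 < MulAction.period (h.partner * h'.partner) x :=
  MulAction.period_pos_of_orderOf_pos (orderOf_pos _) x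

/-- One period of the alternating path, with two vertices for each exponent, lists the component
without repetition. In particular the half-size determines the component up to isomorphism. -/
theorem IsPairing.ncard_supp [Finite X] (x : X) :
    ((pairGraph π π').connectedComponentMk x).supp.ncard =
      2 * MulAction.period (h.partner * h'.partner) x := by
  set m := MulAction.period (h.partner * h'.partner) x with hm
  have hpos : 0 < m := h.period_pos h' x
  let f : Fin m × Bool → X := fun u => altPath h.partner h'.partner x ((u.1 : ℤ), u.2)
  have hf : Function.Injective f := by
    rintro ⟨i, ε⟩ ⟨j, δ⟩ hij
    obtain ⟨h1, h2⟩ := (h.altPath_eq_iff h' x _ _).1 hij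
    rw [← hm] at h2
    have h3 : (i : ℤ) - j = 0 := by
      refine Int.eq_zero_of_abs_lt_dvd h2 ?_
      rw [abs_lt]
      omega
    simp only at h1
    refine Prod.ext (Fin.ext ?_) h1
    simp only
    omega
  have hr : Set.range f = ((pairGraph π π').connectedComponentMk x).supp := by
    ext y
    rw [SimpleGraph.ConnectedComponent.mem_supp_iff, SimpleGraph.ConnectedComponent.eq]
    constructor
    · rintro ⟨u, rfl⟩
      exact (h.reachable_altPath h' x _).symm
    · intro hy
      obtain ⟨⟨i, ε⟩, rfl⟩ := h.exists_altPath_eq h' hy.symm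
      have h0 : (m : ℤ) ≠ 0 := by omega
      refine ⟨(⟨(i % m).toNat, ?_⟩, ε), (h.altPath_eq_iff h' x _ _).2 ⟨rfl, ?_⟩⟩
      · have := Int.emod_lt_of_pos i (b := m) (by omega)
        have := Int.emod_nonneg i h0
        omega
      · rw [← hm]
        simp only
        rw [Int.toNat_of_nonneg (Int.emod_nonneg i h0)]
        have := Int.emod_add_mul_ediv i m
        exact ⟨-(i / m), by linarith⟩
  rw [← hr, ← Set.image_univ, Set.ncard_image_of_injective _ hf, Set.ncard_univ]
  simp [mul_comm]

theorem IsPairing.halfSize_mk [Finite X] (x : X) :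
    halfSize ((pairGraph π π').connectedComponentMk x) =
      MulAction.period (h.partner * h'.partner) x := by
  rw [halfSize, h.ncard_supp h']
  omega

include h h' in
theorem IsPairing.ncard_supp_eq [Finite X] (c : (pairGraph π π').ConnectedComponent) :
    c.supp.ncard = 2 * halfSize c := by
  induction c using SimpleGraph.ConnectedComponent.ind with
  | h x => rw [h.halfSize_mk h', h.ncard_supp h']

include h h' in
theorem IsPairing.halfSize_pos [Finite X] (c : (pairGraph π π').ConnectedComponent) :
    0 < halfSize c := by
  induction c using SimpleGraph.ConnectedComponent.ind with
  | h x => rw [h.halfSize_mk h']; exact h.period_pos h' x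

include h h' in
theorem IsPairing.two_mul_sum_cycleType [Finite X] :
    2 * (cycleType π π').sum = Nat.card X := by
  classical
  have := Fintype.ofFinite X
  rw [cycleType, Finset.sum_map_val, Finset.mul_sum, Nat.card_eq_fintype_card,
    ← Finset.card_univ, Finset.card_eq_sum_card_fiberwise
    (f := (pairGraph π π').connectedComponentMk) (t := Finset.univ) (by simp)]
  refine Finset.sum_congr rfl fun c _ => ?_
  rw [← h.ncard_supp_eq h', ← Set.ncard_coe_finset]
  congr 1
  ext x
  simp [SimpleGraph.ConnectedComponent.mem_supp_iff]

end

/-! ### Isomorphism of graphs with the same cycle type -/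

theorem exists_equiv_of_map_univ_eq {ι κ γ : Type*} [Fintype ι] [Fintype κ]
    (f : ι → γ) (g : κ → γ)
    (h : (Finset.univ : Finset ι).val.map f = (Finset.univ : Finset κ).val.map g) :
    ∃ θ : ι ≃ κ, ∀ i, g (θ i) = f i := by
  classical
  have hc : ∀ c, Nonempty ({i // f i = c} ≃ {j // g j = c}) := by
    intro c
    refine ⟨Fintype.equivOfCardEq ?_⟩
    have := congrArg (Multiset.count c) h
    rw [Multiset.count_map, Multiset.count_map] at this
    rw [Fintype.card_subtype, Fintype.card_subtype]
    simpa [Finset.card, Finset.filter_val, eq_comm] using this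
  exact ⟨Equiv.ofFiberEquiv fun c => (hc c).some, fun i => Equiv.ofFiberEquiv_map _ i⟩

/-- Two graphs of pairings with the same cycle type are isomorphic, by an isomorphism that respects
both pairings. -/
theorem exists_equiv_of_cycleType_eq [Finite X] [Finite Y] {π π' : X → ℕ} {τ τ' : Y → ℕ}
    (h : IsPairing π) (h' : IsPairing π') (k : IsPairing τ) (k' : IsPairing τ')
    (hc : cycleType π π' = cycleType τ τ') :
    ∃ e : X ≃ Y, (∀ x y, π x = π y ↔ τ (e x) = τ (e y)) ∧
      ∀ x y, π' x = π' y ↔ τ' (e x) = τ' (e y) := by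
  obtain ⟨θ, hθ⟩ := exists_equiv_of_map_univ_eq _ _ hc
  let base (c : (pairGraph π π').ConnectedComponent) : X := c.out
  have hbase : ∀ c, (pairGraph π π').connectedComponentMk (base c) = c := fun c => c.out_eq
  let base' (c : (pairGraph τ τ').ConnectedComponent) : Y := c.out
  have hbase' : ∀ c, (pairGraph τ τ').connectedComponentMk (base' c) = c := fun c => c.out_eq
  let v (c : (pairGraph π π').ConnectedComponent) := altPath h.partner h'.partner (base c)
  let w (c : (pairGraph π π').ConnectedComponent) := altPath k.partner k'.partner (base' (θ c))
  have hv : ∀ c u, (pairGraph π π').connectedComponentMk (v c u) = c := fun c u => by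
    rw [← SimpleGraph.ConnectedComponent.eq.2 (h.reachable_altPath h' (base c) u), hbase]
  have hw : ∀ c u, (pairGraph τ τ').connectedComponentMk (w c u) = θ c := fun c u => by
    rw [← SimpleGraph.ConnectedComponent.eq.2 (k.reachable_altPath k' (base' (θ c)) u), hbase']
  -- The period alone decides when two indices give the same vertex. It equals the half-size, which
  -- `θ` preserves.
  have hvw : ∀ c u u', v c u = v c u' ↔ w c u = w c u' := by
    intro c u u'
    have := hθ c
    rw [← hbase c, ← hbase' (θ _), h.halfSize_mk h', k.halfSize_mk k', hbase c] at this
    simp only [v, w]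
    rw [h.altPath_eq_iff h', k.altPath_eq_iff k', this]
  have hex : ∀ x, ∃ u, v ((pairGraph π π').connectedComponentMk x) u = x := fun x =>
    h.exists_altPath_eq h' (SimpleGraph.ConnectedComponent.eq.1 (hbase _))
  choose u hu using hex
  -- The index `u x` is determined only up to the period; `hvw` makes the image independent of this
  -- choice.
  let e (x : X) : Y := w ((pairGraph π π').connectedComponentMk x) (u x)
  have he : ∀ c i, e (v c i) = w c i := by
    intro c i
    have h1 := hu (v c i)
    simp only [e]
    rw [hv] at h1 ⊢
    exact (hvw _ _ _).1 h1
  have hbij : Function.Bijective e := by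
    constructor
    · intro x y hxy
      have h1 := congrArg (pairGraph τ τ').connectedComponentMk hxy
      simp only [e, hw, EmbeddingLike.apply_eq_iff_eq] at h1
      rw [← hu x, ← hu y, ← h1]
      simp only [e] at hxy
      rw [← h1] at hxy
      exact (hvw _ _ _).2 hxy
    · intro y
      obtain ⟨i, hi⟩ := k.exists_altPath_eq k' (SimpleGraph.ConnectedComponent.eq.1
        (hbase' ((pairGraph τ τ').connectedComponentMk y)))
      refine ⟨v (θ.symm ((pairGraph τ τ').connectedComponentMk y)) i, ?_⟩
      rw [he]
      simp only [w, Equiv.apply_symm_apply]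
      exact hi
  -- The partners move indices by the same rule on both paths, so `e` commutes with them.
  have hea : ∀ x, e (h.partner x) = k.partner (e x) := by
    intro x
    conv_lhs => rw [← hu x]
    simp only [v]
    rw [apply_left_altPath h.partner_partner, he]
    exact (apply_left_altPath k.partner_partner _ _).symm
  have heb : ∀ x, e (h'.partner x) = k'.partner (e x) := by
    intro x
    conv_lhs => rw [← hu x]
    simp only [v]
    rw [apply_right_altPath h'.partner_partner, he]
    exact (apply_right_altPath k'.partner_partner _ _).symm
  refine ⟨Equiv.ofBijective e hbij, fun x y => ?_, fun x y => ?_⟩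
  · rw [Equiv.ofBijective_apply, Equiv.ofBijective_apply, h.label_eq_iff, k.label_eq_iff, ← hea,
      hbij.1.eq_iff, hbij.1.eq_iff]
  · rw [Equiv.ofBijective_apply, Equiv.ofBijective_apply, h'.label_eq_iff, k'.label_eq_iff, ← heb,
      hbij.1.eq_iff, hbij.1.eq_iff]

end Pairing

/-! ### Components of three pairings -/

section ThreePairings

variable {X : Type*} {π₀ π₁ π₂ : X → ℕ}

theorem IsPairing.two_mul_card_range [Finite X] {π : X → ℕ} (h : IsPairing π) :
    2 * Nat.card (Set.range π) = Nat.card X := by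
  classical
  have := Fintype.ofFinite X
  rw [← Set.image_univ, Nat.card_coe_set_eq, Set.ncard_eq_toFinset_card', Set.toFinset_image,
    Set.toFinset_univ, Nat.card_eq_fintype_card, ← Finset.card_univ,
    Finset.card_eq_sum_card_image π, Finset.sum_const_nat (m := 2), mul_comm]
  intro k hk
  obtain ⟨x, -, rfl⟩ := Finset.mem_image.1 hk
  have : Finset.univ.filter (fun z => π z = π x) = {x, h.partner x} := by
    ext z
    simp [h.label_eq_iff]
  rw [this, Finset.card_pair (h.partner_ne x).symm]

theorem IsPairing.sum_cycleType [Finite X] {π π' : X → ℕ} (h : IsPairing π) (h' : IsPairing π') :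
    (cycleType π π').sum = Nat.card (Set.range π) := by
  have h1 := h.two_mul_sum_cycleType h'
  have h2 := h.two_mul_card_range
  omega

theorem card_cycleType [Finite X] (π π' : X → ℕ) :
    Multiset.card (cycleType π π') = Fintype.card (pairGraph π π').ConnectedComponent := by
  rw [cycleType, Multiset.card_map]
  rfl

theorem IsPairing.card_cycleType_le [Finite X] {π π' : X → ℕ} (h : IsPairing π)
    (h' : IsPairing π') :
    Multiset.card (cycleType π π') ≤ (cycleType π π').sum := by
  rw [card_cycleType, cycleType, Finset.sum_map_val, ← Finset.card_univ, Finset.card_eq_sum_ones]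
  exact Finset.sum_le_sum fun c _ => h.halfSize_pos h' c

theorem count_one_cycleType [Finite X] (π π' : X → ℕ) :
    (cycleType π π').count 1 =
      {c : (pairGraph π π').ConnectedComponent | halfSize c = 1}.ncard := by
  classical
  rw [cycleType, Multiset.count_map, Set.ncard_eq_toFinset_card']
  simp only [Set.toFinset_ofPred, Finset.card, Finset.filter_val]
  congr 2
  ext c
  exact eq_comm

/-- In a component with two elements, the two partners agree. -/
theorem IsPairing.partner_eq_of_halfSize [Finite X] {π π' : X → ℕ} (h : IsPairing π)
    (h' : IsPairing π')
    {x : X} (hx : halfSize ((pairGraph π π').connectedComponentMk x) = 1) :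
    h.partner x = h'.partner x := by
  have h2 := h.ncard_supp_eq h' ((pairGraph π π').connectedComponentMk x)
  rw [hx, mul_one] at h2
  by_contra hne
  have hsub : ({x, h.partner x, h'.partner x} : Set X) ⊆
      ((pairGraph π π').connectedComponentMk x).supp := by
    rintro y (rfl | rfl | rfl)
    · rfl
    · exact SimpleGraph.ConnectedComponent.eq.2 (reachable_of_left (h.label_partner _))
    · exact SimpleGraph.ConnectedComponent.eq.2 (reachable_of_right (h'.label_partner _))
  have h3 := Set.ncard_le_ncard hsub
  rw [h2, Set.ncard_eq_three.2 ⟨x, _, _, (h.partner_ne x).symm, (h'.partner_ne x).symm, hne, rfl⟩]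
    at h3
  omega

/-- The partners agree there, so the two classes coincide. This is what transfers invariance between
`π₀` and `π₂` in `eq_zero_of_add_mul_eq_zero`. -/
theorem IsPairing.label_eq_iff_of_halfSize [Finite X] {π π' : X → ℕ} (h : IsPairing π)
    (h' : IsPairing π')
    {x y : X} (hx : halfSize ((pairGraph π π').connectedComponentMk x) = 1) :
    π y = π x ↔ π' y = π' x := by
  rw [h.label_eq_iff, h'.label_eq_iff, h.partner_eq_of_halfSize h' hx]

/-- A class of `π` on which `π'` is constant is a component with two elements. -/
theorem IsPairing.halfSize_eq_one {π π' : X → ℕ} (h : IsPairing π) (h' : IsPairing π')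
    {x : X} (hx : ∀ y, π y = π x → π' y = π' x) :
    halfSize ((pairGraph π π').connectedComponentMk x) = 1 := by
  have hp : h.partner x = h'.partner x := by
    rcases h'.label_eq_iff.1 (hx _ (h.label_partner x)) with h1 | h1
    · exact absurd h1 (h.partner_ne x)
    · exact h1
  rw [halfSize]
  have : ((pairGraph π π').connectedComponentMk x).supp = {x, h.partner x} := by
    ext y
    rw [SimpleGraph.ConnectedComponent.mem_supp_iff, SimpleGraph.ConnectedComponent.eq]
    constructor
    · intro hy
      refine Reachable.induction hy.symm (Or.inl rfl) ?_ ?_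
      · rintro u v (rfl | rfl) hv
        · exact h.label_eq_iff.1 hv.symm
        · exact h.label_eq_iff.1 (hv.symm.trans (h.label_partner _))
      · rintro u v (rfl | rfl) hv
        · rw [hp]
          exact h'.label_eq_iff.1 hv.symm
        · rw [hp] at hv ⊢
          exact h'.label_eq_iff.1 (hv.symm.trans (h'.label_partner _))
    · rintro (rfl | rfl)
      · rfl
      · exact reachable_of_left (h.label_partner x)
  rw [this, Set.ncard_pair (h.partner_ne x).symm]

/-- The classes of `π` on which `π'` is constant are components with two elements. -/
theorem IsPairing.ncard_constant_le [Finite X] {π π' : X → ℕ} (h : IsPairing π)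
    (h' : IsPairing π') :
    {i | ∃ x, π x = i ∧ ∀ y, π y = π x → π' y = π' x}.ncard ≤ (cycleType π π').count 1 := by
  classical
  rw [count_one_cycleType]
  have hch : ∀ i ∈ {i | ∃ x, π x = i ∧ ∀ y, π y = π x → π' y = π' x},
      ∃ c : (pairGraph π π').ConnectedComponent, halfSize c = 1 ∧ ∀ x ∈ c.supp, π x = i := by
    rintro _ ⟨x, rfl, hx⟩
    refine ⟨_, h.halfSize_eq_one h' hx, fun y hy => ?_⟩
    rw [SimpleGraph.ConnectedComponent.mem_supp_iff, SimpleGraph.ConnectedComponent.eq] at hy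
    have hh := h.halfSize_eq_one h' hx
    refine Reachable.induction (P := fun y => π y = π x) hy.symm rfl
      (fun u v hu huv => huv ▸ hu) fun u v hu huv => ?_
    rw [h.label_eq_iff_of_halfSize h' hh] at hu ⊢
    exact huv ▸ hu
  rcases Set.eq_empty_or_nonempty
    {i | ∃ x, π x = i ∧ ∀ y, π y = π x → π' y = π' x} with he | ⟨_, x, -⟩
  · rw [he, Set.ncard_empty]
    exact Nat.zero_le _
  have : Nonempty (pairGraph π π').ConnectedComponent := ⟨(pairGraph π π').connectedComponentMk x⟩
  choose! f hf using hch
  refine Set.ncard_le_ncard_of_injOn f (fun i hi => (hf i hi).1) ?_ (Set.toFinite _)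
  intro i hi j hj hij
  have hm : (f i).out ∈ (f i).supp := (f i).out_eq
  rw [← (hf i hi).2 _ hm, (hf j hj).2 _ (hij ▸ hm)]

/-- A component with two elements of the graph of `π₀` and `π₂` that is not a class of `π₁`. -/
def IsSplit (π₁ : X → ℕ) (c : (pairGraph π₀ π₂).ConnectedComponent) : Prop :=
  halfSize c = 1 ∧ ∃ x ∈ c.supp, ∃ y ∈ c.supp, π₁ x ≠ π₁ y

/-- The equivalence relation generated by three labellings. -/
abbrev Linked (π₀ π₁ π₂ : X → ℕ) : X → X → Prop :=
  Relation.ReflTransGen fun x y => π₀ x = π₀ y ∨ π₁ x = π₁ y ∨ π₂ x = π₂ y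

theorem Linked.symm {x y : X} (h : Linked π₀ π₁ π₂ x y) : Linked π₀ π₁ π₂ y x :=
  Relation.ReflTransGen.mono (fun x y h => by simpa only [Function.swap, eq_comm] using h) _ _
    h.swap

theorem linked_of_reachable {x y : X} (h : (pairGraph π₀ π₂).Reachable x y) :
    Linked π₀ π₁ π₂ x y :=
  Reachable.induction (P := Linked π₀ π₁ π₂ x) h .refl (fun _ _ h h' => h.tail (Or.inl h'))
    fun _ _ h h' => h.tail (Or.inr (Or.inr h'))

/-- This is the injectivity behind `card_components_add_le`, argued on one class of the relation
generated by the three pairings. If the class contains a component that is not split, then `w = 1`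
and `F = -G` is invariant under all three labels, hence constant, and it vanishes at the
representative of that component. If all components are split, then `π₀` and `π₂` have the same
classes there, so `F` and `G` are both constant; since `w` is not constant, both vanish. -/
theorem eq_zero_of_add_mul_eq_zero [Finite X] (h₀ : IsPairing π₀) (h₂ : IsPairing π₂)
    (F G : X → ℚ) (w : X → ℚ)
    (hF₁ : ∀ x y, π₁ x = π₁ y → F x = F y) (hF₀ : ∀ x y, π₀ x = π₀ y → F x = F y)
    (hG₁ : ∀ x y, π₁ x = π₁ y → G x = G y) (hG₂ : ∀ x y, π₂ x = π₂ y → G x = G y)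
    (hw₁ : ∀ x, (∀ z, Linked π₀ π₁ π₂ x z →
      IsSplit π₁ ((pairGraph π₀ π₂).connectedComponentMk z)) → w x = π₁ x + 1)
    (hw₀ : ∀ x, ¬ (∀ z, Linked π₀ π₁ π₂ x z →
      IsSplit π₁ ((pairGraph π₀ π₂).connectedComponentMk z)) → w x = 1)
    (hFG : ∀ x, F x + w x * G x = 0)
    (hG : ∀ c : (pairGraph π₀ π₂).ConnectedComponent, ¬ IsSplit π₁ c → G c.out = 0) (x : X) :
    F x = 0 ∧ G x = 0 := by
  by_cases hx : ∀ z, Linked π₀ π₁ π₂ x z → IsSplit π₁ ((pairGraph π₀ π₂).connectedComponentMk z)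
  · have hconst : ∀ z, Linked π₀ π₁ π₂ x z → F z = F x ∧ G z = G x := by
      intro z hz
      induction hz with
      | refl => exact ⟨rfl, rfl⟩
      | @tail u v hu huv ih =>
        have hs := hx u hu
        rw [← ih.1, ← ih.2]
        rcases huv with h | h | h
        · exact ⟨hF₀ _ _ h.symm,
            hG₂ _ _ ((h₀.label_eq_iff_of_halfSize h₂ hs.1).1 h.symm)⟩
        · exact ⟨hF₁ _ _ h.symm, hG₁ _ _ h.symm⟩
        · exact ⟨hF₀ _ _ ((h₀.label_eq_iff_of_halfSize h₂ hs.1).2 h.symm), hG₂ _ _ h.symm⟩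
    -- A split component has two points with different `π₁`-labels, hence with different weights.
    -- Two equations `F + w G = 0` with the same `F` and `G` then force `G = 0`.
    obtain ⟨-, y, hy, z, hz, hne⟩ := hx x .refl
    have hlink : ∀ u ∈ ((pairGraph π₀ π₂).connectedComponentMk x).supp, Linked π₀ π₁ π₂ x u :=
      fun u hu => linked_of_reachable (SimpleGraph.ConnectedComponent.eq.1 hu).symm
    have key : ∀ u, Linked π₀ π₁ π₂ x u → F x + (π₁ u + 1) * G x = 0 := by
      intro u hu
      have := hFG u
      rwa [hw₁ u fun z hz => hx z (hu.trans hz), (hconst u hu).1, (hconst u hu).2] at this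
    have h1 := key y (hlink y hy)
    have h2 := key z (hlink z hz)
    have h3 : ((π₁ y : ℚ) - π₁ z) * G x = 0 := by linarith
    have h4 : G x = 0 := by
      refine (mul_eq_zero.1 h3).resolve_left fun h => hne ?_
      exact_mod_cast sub_eq_zero.1 h
    rw [h4] at h1
    exact ⟨by simpa using h1, h4⟩
  · have hcls : ∀ z, Linked π₀ π₁ π₂ x z → F z = - G z := by
      intro z hz
      have := hFG z
      rw [hw₀ z fun h => hx fun u hu => h u (hz.symm.trans hu)] at this
      linarith
    have hconst : ∀ z, Linked π₀ π₁ π₂ x z → G z = G x := by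
      intro z hz
      induction hz with
      | refl => rfl
      | @tail u v hu huv ih =>
        rw [← ih]
        rcases huv with h | h | h
        · have h1 := hcls u hu
          have h2 := hcls v (hu.tail (Or.inl h))
          have h3 := hF₀ _ _ h
          linarith
        · exact hG₁ _ _ h.symm
        · exact hG₂ _ _ h.symm
    -- Here `G` is constant on the linked class and is zero at the chosen representative of a
    -- component that is not split.
    push Not at hx
    obtain ⟨z, hz, hns⟩ := hx
    have h0 := hG _ hns
    have hl : Linked π₀ π₁ π₂ x ((pairGraph π₀ π₂).connectedComponentMk z).out :=
      hz.trans (linked_of_reachable (SimpleGraph.ConnectedComponent.eq.1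
        ((pairGraph π₀ π₂).connectedComponentMk z).out_eq).symm)
    rw [hconst _ hl] at h0
    rw [hcls x .refl, h0]
    simp

/-- Dimension count. A function on the components of (π₀, π₁) together with one on the components of
(π₁, π₂) is sent to a weighted sum on the classes of `π₁` and to the values of the second function
at the components of (π₀, π₂) that are not split. Injectivity of this map is the inequality. With
constant weights the pair (1, -1) would lie in the kernel on a linked class all of whose components
are split; varying the weight there is what gains the extra term. -/
theorem card_components_add_le [Finite X] (h₀ : IsPairing π₀) (h₂ : IsPairing π₂) :
    Fintype.card (pairGraph π₀ π₁).ConnectedComponent +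
      Fintype.card (pairGraph π₁ π₂).ConnectedComponent +
      {c : (pairGraph π₀ π₂).ConnectedComponent | IsSplit π₁ c}.ncard ≤
    Nat.card (Set.range π₁) + Fintype.card (pairGraph π₀ π₂).ConnectedComponent := by
  classical
  have := Fintype.ofFinite (Set.range π₁)
  let w : X → ℚ := fun x => if ∀ z, Linked π₀ π₁ π₂ x z →
      IsSplit π₁ ((pairGraph π₀ π₂).connectedComponentMk z) then (π₁ x : ℚ) + 1 else 1
  have hw : ∀ x y, π₁ x = π₁ y → w x = w y := by
    intro x y h
    have hl : Linked π₀ π₁ π₂ x y := .single (Or.inr (Or.inl h))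
    have : (∀ z, Linked π₀ π₁ π₂ x z → IsSplit π₁ ((pairGraph π₀ π₂).connectedComponentMk z)) ↔
        ∀ z, Linked π₀ π₁ π₂ y z → IsSplit π₁ ((pairGraph π₀ π₂).connectedComponentMk z) :=
      ⟨fun H z hz => H z (hl.trans hz), fun H z hz => H z (hl.symm.trans hz)⟩
    simp only [w, this, h]
  let rep (k : Set.range π₁) : X := k.2.choose
  have hrep : ∀ k, π₁ (rep k) = k := fun k => k.2.choose_spec
  let L : (((pairGraph π₀ π₁).ConnectedComponent → ℚ) ×
      ((pairGraph π₁ π₂).ConnectedComponent → ℚ)) →ₗ[ℚ]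
      (Set.range π₁ → ℚ) ×
        ({c : (pairGraph π₀ π₂).ConnectedComponent // ¬ IsSplit π₁ c} → ℚ) :=
    { toFun := fun p =>
        (fun k => p.1 ((pairGraph π₀ π₁).connectedComponentMk (rep k)) +
          w (rep k) * p.2 ((pairGraph π₁ π₂).connectedComponentMk (rep k)),
         fun c => p.2 ((pairGraph π₁ π₂).connectedComponentMk c.1.out))
      map_add' := fun p q => by
        ext k <;> simp
        ring
      map_smul' := fun c p => by
        ext k <;> simp
        ring }
  have hL : Function.Injective L := by
    rw [← LinearMap.ker_eq_bot, LinearMap.ker_eq_bot']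
    rintro ⟨f, g⟩ hfg
    obtain ⟨h1, h2⟩ := Prod.ext_iff.1 hfg
    have hmain := eq_zero_of_add_mul_eq_zero h₀ h₂
      (fun x => f ((pairGraph π₀ π₁).connectedComponentMk x))
      (fun x => g ((pairGraph π₁ π₂).connectedComponentMk x)) w
      (fun x y h => congrArg f (SimpleGraph.ConnectedComponent.eq.2 (reachable_of_right h)))
      (fun x y h => congrArg f (SimpleGraph.ConnectedComponent.eq.2 (reachable_of_left h)))
      (fun x y h => congrArg g (SimpleGraph.ConnectedComponent.eq.2 (reachable_of_left h)))
      (fun x y h => congrArg g (SimpleGraph.ConnectedComponent.eq.2 (reachable_of_right h)))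
      (fun x hx => if_pos hx) (fun x hx => if_neg hx)
      (fun x => by
        have hk := congrFun h1 ⟨π₁ x, x, rfl⟩
        have hr := hrep ⟨π₁ x, x, rfl⟩
        simp only [L, LinearMap.coe_mk, AddHom.coe_mk] at hk
        rw [hw _ _ hr, SimpleGraph.ConnectedComponent.eq.2 (reachable_of_right hr),
          SimpleGraph.ConnectedComponent.eq.2 (reachable_of_left hr)] at hk
        exact hk)
      (fun c hc => congrFun h2 ⟨c, hc⟩)
    refine Prod.ext (funext fun c => ?_) (funext fun c => ?_)
    · induction c using SimpleGraph.ConnectedComponent.ind with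
      | h x => exact (hmain x).1
    · induction c using SimpleGraph.ConnectedComponent.ind with
      | h x => exact (hmain x).2
  have hle := LinearMap.finrank_le_finrank_of_injective hL
  rw [Module.finrank_prod, Module.finrank_prod, Module.finrank_fintype_fun_eq_card,
    Module.finrank_fintype_fun_eq_card, Module.finrank_fintype_fun_eq_card,
    Module.finrank_fintype_fun_eq_card, Fintype.card_subtype_compl] at hle
  have hs : {c : (pairGraph π₀ π₂).ConnectedComponent | IsSplit π₁ c}.ncard =
      Fintype.card {c : (pairGraph π₀ π₂).ConnectedComponent // IsSplit π₁ c} := by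
    rw [← Nat.card_eq_fintype_card]
    rfl
  have hs' := Fintype.card_subtype_le (fun c : (pairGraph π₀ π₂).ConnectedComponent => IsSplit π₁ c)
  rw [hs, Nat.card_eq_fintype_card]
  omega

/-- The components with two elements of the graph of `π₀` and `π₂` that are not split. -/
theorem count_one_le [Finite X] (h₀ : IsPairing π₀) (h₁ : IsPairing π₁) (h₂ : IsPairing π₂) :
    (cycleType π₀ π₂).count 1 ≤
      {c : (pairGraph π₀ π₂).ConnectedComponent | IsSplit π₁ c}.ncard +
      {i | ∃ x, π₁ x = i ∧ (∀ y, π₁ y = π₁ x → π₀ y = π₀ x) ∧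
        ∀ y, π₁ y = π₁ x → π₂ y = π₂ x}.ncard := by
  classical
  rw [count_one_cycleType]
  set U := {c : (pairGraph π₀ π₂).ConnectedComponent | IsSplit π₁ c} with hU
  set V := {c : (pairGraph π₀ π₂).ConnectedComponent |
    halfSize c = 1 ∧ ∀ x ∈ c.supp, ∀ y ∈ c.supp, π₁ x = π₁ y} with hV
  have hsub : {c : (pairGraph π₀ π₂).ConnectedComponent | halfSize c = 1} ⊆ U ∪ V := by
    intro c hc
    by_cases h : IsSplit π₁ c
    · exact Or.inl h
    · refine Or.inr ⟨hc, fun x hx y hy => ?_⟩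
      by_contra hne
      exact h ⟨hc, x, hx, y, hy, hne⟩
  refine (Set.ncard_le_ncard hsub (Set.toFinite _)).trans ((Set.ncard_union_le _ _).trans ?_)
  refine Nat.add_le_add_left ?_ _
  have hout : ∀ c : (pairGraph π₀ π₂).ConnectedComponent, c.out ∈ c.supp := fun c => c.out_eq
  -- Since `π₁` is constant on such a component, the partners for `π₀` and `π₁` agree. The component
  -- is therefore a class of each of the three pairings and is determined by its `π₁`-label.
  have hcl : ∀ c ∈ V, ∀ y, π₁ y = π₁ c.out → y ∈ c.supp ∧ π₀ y = π₀ c.out ∧ π₂ y = π₂ c.out := by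
    rintro c ⟨hc1, hc2⟩ y hy
    have hm : (pairGraph π₀ π₂).connectedComponentMk c.out = c := hout c
    have hp : h₀.partner c.out ∈ c.supp := by
      rw [SimpleGraph.ConnectedComponent.mem_supp_iff]
      conv_rhs => rw [← hm]
      exact SimpleGraph.ConnectedComponent.eq.2 (reachable_of_left (h₀.label_partner _))
    rw [← hm] at hc1
    have h2 := (h₀.label_eq_iff_of_halfSize h₂ hc1).1 (h₀.label_partner _)
    rcases h₁.label_eq_iff.1 hy with h | h
    · rw [h]
      exact ⟨hout c, rfl, rfl⟩
    · have h3 : h₀.partner c.out = h₁.partner c.out :=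
        (h₁.label_eq_iff.1 (hc2 _ hp _ (hout c))).resolve_left (h₀.partner_ne _)
      rw [h, ← h3]
      exact ⟨hp, h₀.label_partner _, h2⟩
  refine Set.ncard_le_ncard_of_injOn (fun c => π₁ c.out) (fun c hc => ?_) ?_ ?_
  · exact ⟨_, rfl, fun y hy => (hcl c hc y hy).2.1, fun y hy => (hcl c hc y hy).2.2⟩
  · intro c hc d hd hcd
    have h1 : d.out ∈ c.supp := (hcl c hc _ hcd.symm).1
    have h2 : d.out ∈ d.supp := hout d
    rw [SimpleGraph.ConnectedComponent.mem_supp_iff] at h1 h2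
    rw [← h1, h2]
  · refine (Set.finite_range π₁).subset ?_
    rintro _ ⟨x, rfl, -⟩
    exact ⟨x, rfl⟩

end ThreePairings

/-! ### Permutations of pairs -/

/-- The complements in `Fin n` also have equal size, so a bijection from `D` to `D'` extends to `Fin
n`, and then by the identity. -/
theorem exists_perm_of_card_eq {n : ℕ} {D D' : Finset ℕ} (hD : ∀ k ∈ D, k < n)
    (hD' : ∀ k ∈ D', k < n) (h : D.card = D'.card) :
    ∃ q : Equiv.Perm ℕ, (∀ k, n ≤ k → q k = k) ∧ ∀ k, q k ∈ D' ↔ k ∈ D := by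
  classical
  have hc : ∀ D : Finset ℕ, (∀ k ∈ D, k < n) → Fintype.card {x : Fin n // x.1 ∈ D} = D.card := by
    intro D hD
    rw [← Fintype.card_coe D]
    exact Fintype.card_congr
      ⟨fun x => ⟨x.1.1, x.2⟩, fun x => ⟨⟨x.1, hD _ x.2⟩, x.2⟩, fun _ => rfl, fun _ => rfl⟩
  let e : {x : Fin n // x.1 ∈ D} ≃ {x : Fin n // x.1 ∈ D'} :=
    Fintype.equivOfCardEq (by rw [hc D hD, hc D' hD', h])
  refine ⟨e.extendSubtype.extendDomain Fin.equivSubtype, fun k hk => ?_, fun k => ?_⟩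
  · exact Equiv.Perm.extendDomain_apply_not_subtype _ _ (not_lt.2 hk)
  · by_cases hk : k < n
    · have : (e.extendSubtype.extendDomain Fin.equivSubtype) k = e.extendSubtype ⟨k, hk⟩ := by
        rw [Equiv.Perm.extendDomain_apply_subtype (p := (· < n)) _ _ hk]
        rfl
      rw [this]
      constructor
      · intro h1
        by_contra h2
        exact e.extendSubtype_not_mem ⟨k, hk⟩ h2 h1
      · exact fun h1 => e.extendSubtype_mem ⟨k, hk⟩ h1
    · rw [Equiv.Perm.extendDomain_apply_not_subtype (p := (· < n)) _ _ hk]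
      exact ⟨fun h => absurd (hD' _ h) hk, fun h => absurd (hD _ h) hk⟩

/-- The permutation of labels induced by a permutation of the pairs. -/
def pairPerm {n : ℕ} (q : Equiv.Perm ℕ) (hq : ∀ k, n ≤ k → q k = k) : hyperoctahedral n :=
  ⟨q.prodCongr (Equiv.refl Bool), fun _ hx => Prod.ext (hq _ hx) rfl, fun _ _ _ => rfl⟩

/-- The set `P` is a union of pairs contained in `[2n]`. -/
structure IsPairUnion (n : ℕ) (P : Set Pt) : Prop where
  lt : ∀ x ∈ P, x.1 < n
  pair : ∀ k b b', (k, b) ∈ P → (k, b') ∈ P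

namespace IsPairUnion

variable {n : ℕ} {P Q : Set Pt}

theorem mem_of_fst_eq (hP : IsPairUnion n P) {x y : Pt} (h : x.1 = y.1) (hx : x ∈ P) : y ∈ P := by
  obtain ⟨k, b⟩ := x
  obtain ⟨l, b'⟩ := y
  obtain rfl : k = l := h
  exact hP.pair k b b' hx

theorem mem_iff_of_fst_eq (hP : IsPairUnion n P) {x y : Pt} (h : x.1 = y.1) : x ∈ P ↔ y ∈ P :=
  ⟨hP.mem_of_fst_eq h, hP.mem_of_fst_eq h.symm⟩

theorem finite (hP : IsPairUnion n P) : P.Finite :=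
  ((Set.finite_lt_nat n).prod (Set.finite_univ (α := Bool))).subset
    fun x hx => ⟨hP.lt x hx, trivial⟩

theorem isPairing (hP : IsPairUnion n P) : IsPairing fun x : P => x.1.1 := by
  rintro ⟨⟨k, b⟩, hx⟩
  refine ⟨⟨(k, !b), hP.pair _ _ _ hx⟩, ?_, ?_⟩
  · intro h
    have := congrArg (fun z : P => z.1.2) h
    simp at this
  · rintro ⟨⟨l, c⟩, hz⟩
    simp only [Subtype.mk.injEq, Prod.mk.injEq]
    cases b <;> cases c <;> simp

open Classical in
/-- The set of indices of the pairs contained in `P`. -/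
def pairs (_ : IsPairUnion n P) : Finset ℕ := (Finset.range n).filter fun k => (k, false) ∈ P

theorem mem_pairs (hP : IsPairUnion n P) (x : Pt) : x.1 ∈ hP.pairs ↔ x ∈ P := by
  classical
  rw [pairs, Finset.mem_filter, Finset.mem_range,
    hP.mem_iff_of_fst_eq (x := (x.1, false)) (y := x) rfl]
  exact ⟨fun h => h.2, fun h => ⟨hP.lt _ h, h⟩⟩

theorem lt_of_mem_pairs (hP : IsPairUnion n P) {k : ℕ} (h : k ∈ hP.pairs) : k < n :=
  hP.lt (k, false) ((hP.mem_pairs (k, false)).1 h)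

theorem range_fst (hP : IsPairUnion n P) : (Set.range fun x : P => x.1.1) = hP.pairs := by
  ext k
  constructor
  · rintro ⟨x, rfl⟩
    exact (hP.mem_pairs _).2 x.2
  · intro hk
    exact ⟨⟨(k, false), (hP.mem_pairs _).1 hk⟩, rfl⟩

theorem card_range_fst (hP : IsPairUnion n P) :
    Nat.card (Set.range fun x : P => x.1.1) = hP.pairs.card := by
  rw [hP.range_fst]
  simp

theorem two_mul_card_pairs (hP : IsPairUnion n P) : 2 * hP.pairs.card = Nat.card P := by
  have : Finite P := hP.finite
  rw [← hP.card_range_fst, hP.isPairing.two_mul_card_range]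

/-- A bijection between unions of pairs that respects the pairs extends to an element of the
hyperoctahedral group. -/
theorem exists_extension (hP : IsPairUnion n P) (hQ : IsPairUnion n Q) (e : P ≃ Q)
    (he : ∀ x y, x.1.1 = y.1.1 → (e x).1.1 = (e y).1.1) :
    ∃ w : hyperoctahedral n, ∀ x : P, w.1 x = e x := by
  classical
  -- Outside `P` the pairs are moved as wholes by `q`, which sends the pairs not in `P` to those not
  -- in `Q`.
  obtain ⟨q, hq, hqm⟩ := exists_perm_of_card_eq (D := hP.pairs) (D' := hQ.pairs)
    (fun k => hP.lt_of_mem_pairs) (fun k => hQ.lt_of_mem_pairs) (by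
      have h1 := hP.two_mul_card_pairs
      have h2 := hQ.two_mul_card_pairs
      have h3 := Nat.card_congr e
      omega)
  have hPQ : ∀ x : Pt, x ∉ P ↔ q.prodCongr (Equiv.refl Bool) x ∉ Q := by
    intro x
    rw [← hP.mem_pairs, ← hQ.mem_pairs, not_iff_not]
    exact (hqm x.1).symm
  let f : {x : Pt // x ∉ P} ≃ {x : Pt // x ∉ Q} :=
    (q.prodCongr (Equiv.refl Bool)).subtypeEquiv hPQ
  let w : Equiv.Perm Pt := Equiv.subtypeCongr (p := (· ∈ P)) (q := (· ∈ Q)) e f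
  have hw : ∀ (x : Pt) (hx : x ∈ P), w x = e ⟨x, hx⟩ := fun x hx => by
    simp [w, Equiv.subtypeCongr, Equiv.sumCompl_symm_apply_of_pos hx]
  have hw' : ∀ (x : Pt) (hx : x ∉ P), w x = (q x.1, x.2) := fun x hx => by
    simp [w, f, Equiv.subtypeCongr, Equiv.sumCompl_symm_apply_of_neg hx, Prod.map]
  refine ⟨⟨w, fun x hx => ?_, fun k b b' => ?_⟩, fun x => hw x.1 x.2⟩
  · rw [hw' x fun h => absurd (hP.lt x h) (not_lt.2 hx), hq _ hx]
  · by_cases h : (k, b) ∈ P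
    · rw [hw _ h, hw _ (hP.pair k b b' h)]
      exact he _ _ rfl
    · rw [hw' _ h, hw' _ fun h' => h (hP.pair k b' b h')]

end IsPairUnion

namespace PBij

variable {n : ℕ} (α β : PBij n)

/-! ### Domains, codomains and labels -/

theorem isPairUnion_dom : IsPairUnion n α.dom := ⟨α.dom_lt, α.dom_pair⟩

theorem isPairUnion_cod : IsPairUnion n α.cod := ⟨α.cod_lt, α.cod_pair⟩

/-- The pairs of the domain. -/
def domPairs : Finset ℕ := α.isPairUnion_dom.pairs

/-- The pairs of the codomain. -/
def codPairs : Finset ℕ := α.isPairUnion_cod.pairs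

theorem mem_domPairs {α : PBij n} (x : Pt) : x.1 ∈ α.domPairs ↔ x ∈ α.dom :=
  α.isPairUnion_dom.mem_pairs x

theorem mem_codPairs {α : PBij n} (x : Pt) : x.1 ∈ α.codPairs ↔ x ∈ α.cod :=
  α.isPairUnion_cod.mem_pairs x

variable {α β}

theorem mem_dom {x : Pt} : x ∈ α.dom ↔ ∃ y, α.map x = some y := Option.isSome_iff_exists

theorem mem_cod {y : Pt} : y ∈ α.cod ↔ ∃ x, α.map x = some y := by
  refine Option.isSome_iff_exists.trans (exists_congr fun x => ?_)
  exact α.map.eq_some_iff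

theorem map_eq_app (x : α.dom) : α.map x.1 = some (α.app x) := (Option.some_get x.2).symm

theorem app_eq_of_map {x : α.dom} {y : Pt} (h : α.map x.1 = some y) : α.app x = y :=
  Option.some_injective _ ((map_eq_app x).symm.trans h)

theorem map_injective {x x' y : Pt} (h : α.map x = some y) (h' : α.map x' = some y) : x = x' :=
  α.map.inj h h'

variable (α) in
/-- The bijection between the domain and the codomain. -/
def domEquiv : α.dom ≃ α.cod :=
  Equiv.ofBijective (fun x => ⟨α.app x, mem_cod.2 ⟨_, map_eq_app x⟩⟩) <| by
    constructor
    · intro x x' h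
      have h1 := map_eq_app x
      rw [Subtype.mk.inj h] at h1
      exact Subtype.ext (map_injective h1 (map_eq_app x'))
    · rintro ⟨y, hy⟩
      obtain ⟨x, hx⟩ := mem_cod.1 hy
      exact ⟨⟨x, mem_dom.2 ⟨y, hx⟩⟩, Subtype.ext (app_eq_of_map hx)⟩

theorem coe_domEquiv (x : α.dom) : (α.domEquiv x : Pt) = α.app x := rfl

theorem ext_of_le (h : ∀ x y, α.map x = some y → β.map x = some y) (hd : β.dom ⊆ α.dom) :
    α = β := by
  refine PBij.ext (PEquiv.ext fun x => Option.ext fun y => ⟨h x y, fun hy => ?_⟩)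
  obtain ⟨z, hz⟩ := mem_dom.1 (hd (mem_dom.2 ⟨y, hy⟩))
  have := h x z hz
  rw [hz, ← this, hy]

variable (α) in
/-- The index of the pair of a point of the domain. -/
def outer (x : α.dom) : ℕ := x.1.1

variable (α) in
/-- The index of the pair of the image of a point of the domain. -/
def inner (x : α.dom) : ℕ := (α.app x).1

theorem isPairing_outer : IsPairing α.outer := α.isPairUnion_dom.isPairing

theorem isPairing_inner : IsPairing α.inner := α.isPairUnion_cod.isPairing.comp α.domEquiv

theorem cosetType_eq : α.cosetType = cycleType α.outer α.inner := rfl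

theorem cosetType_sum_eq_card_domPairs : α.cosetType.sum = α.domPairs.card := by
  rw [cosetType_eq, isPairing_outer.sum_cycleType isPairing_inner]
  exact α.isPairUnion_dom.card_range_fst

theorem card_codPairs : α.codPairs.card = α.domPairs.card := by
  have h1 := α.isPairUnion_dom.two_mul_card_pairs
  have h2 := α.isPairUnion_cod.two_mul_card_pairs
  have h3 := Nat.card_congr α.domEquiv
  unfold codPairs domPairs
  omega

theorem card_domPairs_le : α.domPairs.card ≤ n := by
  have h : α.domPairs ⊆ Finset.range n := fun k hk =>
    Finset.mem_range.2 (α.isPairUnion_dom.lt_of_mem_pairs hk)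
  simpa using Finset.card_le_card h

theorem cosetType_sum_le : α.cosetType.sum ≤ n :=
  cosetType_sum_eq_card_domPairs.trans_le card_domPairs_le

theorem cosetType_pos {i : ℕ} (hi : i ∈ α.cosetType) : 0 < i := by
  obtain ⟨c, -, rfl⟩ := Multiset.mem_map.1 hi
  exact isPairing_outer.halfSize_pos isPairing_inner c

/-! ### The action of the hyperoctahedral group -/

theorem map_act {a b : hyperoctahedral n} {x y : Pt} :
    (act a b α).map x = some y ↔ α.map (b.1⁻¹ x) = some (a.1⁻¹ y) := by
  change ((b.1⁻¹).toPEquiv.trans (α.map.trans a.1.toPEquiv)) x = some y ↔ _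
  simp only [PEquiv.trans_eq_some, Equiv.toPEquiv_apply, Option.some.injEq]
  constructor
  · rintro ⟨_, rfl, w, hw, rfl⟩
    simpa using hw
  · intro h
    exact ⟨_, rfl, _, h, by simp⟩

theorem mem_dom_act {a b : hyperoctahedral n} {x : Pt} :
    x ∈ (act a b α).dom ↔ b.1⁻¹ x ∈ α.dom := by
  simp only [mem_dom, map_act]
  exact ⟨fun ⟨y, hy⟩ => ⟨_, hy⟩, fun ⟨y, hy⟩ => ⟨a.1 y, by simpa using hy⟩⟩

theorem mem_cod_act {a b : hyperoctahedral n} {y : Pt} :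
    y ∈ (act a b α).cod ↔ a.1⁻¹ y ∈ α.cod := by
  simp only [mem_cod, map_act]
  exact ⟨fun ⟨y, hy⟩ => ⟨_, hy⟩, fun ⟨y, hy⟩ => ⟨b.1 y, by simpa using hy⟩⟩

theorem act_act (a b a' b' : hyperoctahedral n) :
    act a b (act a' b' α) = act (a * a') (b * b') α := by
  refine PBij.ext (PEquiv.ext fun x => Option.ext fun y => ?_)
  rw [map_act, map_act, map_act]
  simp

theorem act_one : act 1 1 α = α := by
  refine PBij.ext (PEquiv.ext fun x => Option.ext fun y => ?_)
  rw [map_act]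
  simp

/-- The action of a pair of elements of the hyperoctahedral group as a permutation. -/
def actPerm (a b : hyperoctahedral n) : Equiv.Perm (PBij n) where
  toFun := act a b
  invFun := act a⁻¹ b⁻¹
  left_inv α := by rw [act_act, inv_mul_cancel, inv_mul_cancel, act_one]
  right_inv α := by rw [act_act, mul_inv_cancel, mul_inv_cancel, act_one]

theorem fst_eq_iff (w : hyperoctahedral n) {x y : Pt} : (w.1 x).1 = (w.1 y).1 ↔ x.1 = y.1 := by
  have key : ∀ (w : hyperoctahedral n) {x y : Pt}, x.1 = y.1 → (w.1 x).1 = (w.1 y).1 := by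
    rintro w ⟨k, b⟩ ⟨l, c⟩ (rfl : k = l)
    exact w.2.2 k b c
  refine ⟨fun h => ?_, key w⟩
  simpa using key w⁻¹ h

theorem cosetType_act (a b : hyperoctahedral n) : (act a b α).cosetType = α.cosetType := by
  rw [cosetType_eq, cosetType_eq]
  let e : α.dom ≃ (act a b α).dom := b.1.subtypeEquiv fun x => by
    rw [mem_dom_act]
    simp
  have he : ∀ x, (act a b α).app (e x) = a.1 (α.app x) := fun x => app_eq_of_map <| by
    change (act a b α).map (b.1 x) = _
    rw [map_act]
    simpa using map_eq_app x
  refine (cycleType_congr e (fun x y => ?_) fun x y => ?_).symm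
  · exact (fst_eq_iff b).symm
  · unfold inner
    rw [he, he]
    exact (fst_eq_iff a).symm

/-- Partial bijections with the same coset-type are in the same orbit. -/
theorem exists_act_of_cosetType_eq (h : α.cosetType = β.cosetType) :
    ∃ a b : hyperoctahedral n, act a b α = β := by
  obtain ⟨e, he, he'⟩ := exists_equiv_of_cycleType_eq isPairing_outer isPairing_inner
    isPairing_outer isPairing_inner h
  obtain ⟨b, hb⟩ := α.isPairUnion_dom.exists_extension β.isPairUnion_dom e
    fun x y => (he x y).1
  -- The isomorphism of graphs preserves exterior classes, which gave `b`. Transported to the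
  -- codomains, it preserves pairs because it preserves interior classes, which gives `a`.
  obtain ⟨a, ha⟩ := α.isPairUnion_cod.exists_extension β.isPairUnion_cod
    ((α.domEquiv.symm.trans e).trans β.domEquiv) fun x y hxy => by
      obtain ⟨x, rfl⟩ := α.domEquiv.surjective x
      obtain ⟨y, rfl⟩ := α.domEquiv.surjective y
      simp only [Equiv.trans_apply, Equiv.symm_apply_apply]
      exact (he' x y).1 hxy
  have key : ∀ x : α.dom, β.map (b.1 x) = some (a.1 (α.app x)) := by
    intro x
    have h1 := ha (α.domEquiv x)
    rw [coe_domEquiv] at h1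
    rw [h1, hb]
    simp only [Equiv.trans_apply, Equiv.symm_apply_apply]
    exact map_eq_app (e x)
  refine ⟨a, b, ext_of_le (fun x y hxy => ?_) fun x hx => ?_⟩
  · rw [map_act] at hxy
    have := key ⟨b.1⁻¹ x, mem_dom.2 ⟨_, hxy⟩⟩
    rw [app_eq_of_map hxy] at this
    simpa using this
  · rw [mem_dom_act]
    obtain ⟨y, hy⟩ := e.surjective ⟨x, hx⟩
    have : b.1 y = x := by rw [hb, hy]
    rw [← this]
    simp

end PBij

/-! ### Invariant elements -/

section Invariants

variable {n : ℕ}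

theorem PBAlg.ext {x y : PBAlg n} (h : ∀ α, coeff x α = coeff y α) : x = y := Finsupp.ext h

theorem coeff_sum {ι : Type*} (s : Finset ι) (f : ι → PBAlg n) (α : PBij n) :
    coeff (∑ i ∈ s, f i) α = ∑ i ∈ s, coeff (f i) α :=
  map_sum (Finsupp.applyAddHom α : (PBij n →₀ ℂ) →+ ℂ) f s

theorem coeff_actLin (a b : hyperoctahedral n) (x : PBAlg n) (α : PBij n) :
    coeff (actLin a b x) (act a b α) = coeff x α := by
  classical
  change coeff (∑ β : PBij n, coeff x β • basisVec (act a b β)) _ = _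
  have h : ∀ β, act a b β = act a b α ↔ β = α := fun β => (PBij.actPerm a b).injective.eq_iff
  simp [coeff_sum, coeff_basisVec, h]

theorem coeff_act {x : PBAlg n} (hx : x ∈ AInv n) (a b : hyperoctahedral n) (α : PBij n) :
    coeff x (act a b α) = coeff x α := by
  conv_lhs => rw [← hx a b]
  exact coeff_actLin a b x α

theorem mem_AInv_of_coeff_act {x : PBAlg n}
    (hx : ∀ (a b : hyperoctahedral n) α, coeff x (act a b α) = coeff x α) : x ∈ AInv n := by
  intro a b
  refine PBAlg.ext fun α => ?_
  obtain ⟨β, rfl⟩ := (PBij.actPerm a b).surjective α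
  exact (coeff_actLin a b x β).trans (hx a b β).symm

/-- The partial bijections with a given coset-type form one orbit, so an invariant element is known
from one coefficient per coset-type. -/
theorem coeff_eq_of_cosetType_eq {x : PBAlg n} (hx : x ∈ AInv n) {α β : PBij n}
    (h : α.cosetType = β.cosetType) : coeff x α = coeff x β := by
  obtain ⟨a, b, rfl⟩ := PBij.exists_act_of_cosetType_eq h
  exact (coeff_act hx a b α).symm

theorem S_mem_AInv (r : Ptn) (n : ℕ) : S r n ∈ AInv n :=
  mem_AInv_of_coeff_act fun a b α => by rw [coeff_S, coeff_S, PBij.cosetType_act]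

end Invariants

namespace PBij

variable {n : ℕ} {α β γ α₁ α₂ : PBij n}

/-! ### Composition and trivial extensions -/

theorem map_comp {p : Composable n} {x z : Pt} :
    (comp p).map x = some z ↔ ∃ y, p.1.2.map x = some y ∧ p.1.1.map y = some z :=
  PEquiv.trans_eq_some _ _ _ _

theorem dom_comp (p : Composable n) : (comp p).dom = p.1.2.dom := by
  ext x
  simp only [mem_dom, map_comp]
  constructor
  · rintro ⟨z, y, hy, -⟩
    exact ⟨y, hy⟩
  · rintro ⟨y, hy⟩
    have h : y ∈ p.1.1.dom := by
      rw [p.2]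
      exact mem_cod.2 ⟨x, hy⟩
    obtain ⟨z, hz⟩ := mem_dom.1 h
    exact ⟨z, y, hy, hz⟩

theorem cod_comp (p : Composable n) : (comp p).cod = p.1.1.cod := by
  ext z
  simp only [mem_cod, map_comp]
  constructor
  · rintro ⟨x, y, -, hz⟩
    exact ⟨y, hz⟩
  · rintro ⟨y, hz⟩
    have h : y ∈ p.1.2.cod := by
      rw [← p.2]
      exact mem_dom.2 ⟨z, hz⟩
    obtain ⟨x, hx⟩ := mem_cod.1 h
    exact ⟨x, y, hx, hz⟩

theorem domPairs_congr {m : ℕ} {α : PBij n} {β : PBij m} (h : α.dom = β.dom) :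
    α.domPairs = β.domPairs := by
  ext k
  rw [mem_domPairs (k, false), mem_domPairs (k, false), h]

theorem codPairs_congr {m : ℕ} {α : PBij n} {β : PBij m} (h : α.cod = β.cod) :
    α.codPairs = β.codPairs := by
  ext k
  rw [mem_codPairs (k, false), mem_codPairs (k, false), h]

theorem card_domPairs_fst (p : Composable n) :
    p.1.1.domPairs.card = (comp p).domPairs.card := by
  rw [domPairs_congr (dom_comp p), ← card_codPairs (α := p.1.2)]
  congr 1
  ext k
  rw [mem_domPairs (k, false), mem_codPairs (k, false), p.2]

theorem map_le_iff : α.map ≤ β.map ↔ ∀ x y, α.map x = some y → β.map x = some y := Iff.rfl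

theorem dom_subset_of_le (h : α.map ≤ β.map) : α.dom ⊆ β.dom := fun x hx => by
  obtain ⟨y, hy⟩ := mem_dom.1 hx
  exact mem_dom.2 ⟨y, h x y hy⟩

theorem cod_subset_of_le (h : α.map ≤ β.map) : α.cod ⊆ β.cod := fun y hy => by
  obtain ⟨x, hx⟩ := mem_cod.1 hy
  exact mem_cod.2 ⟨x, h x y hx⟩

theorem mem_E {p : Composable n} : p ∈ E α₁ α₂ ↔
    α₁.IsTrivialExt p.1.1 ∧ α₂.IsTrivialExt p.1.2 ∧ p.1.1.dom = α₁.dom ∪ α₂.cod := by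
  simp [E]

theorem domPairs_of_mem_E {p : Composable n} (hp : p ∈ E α₁ α₂) :
    p.1.1.domPairs = α₁.domPairs ∪ α₂.codPairs := by
  ext k
  rw [Finset.mem_union, mem_domPairs (k, false), mem_domPairs (k, false), mem_codPairs (k, false),
    (mem_E.1 hp).2.2]
  rfl

theorem IsTrivialExt.act (h : α.IsTrivialExt β) (a b : hyperoctahedral n) :
    (act a b α).IsTrivialExt (HeckeFiltration.act a b β) := by
  refine ⟨map_le_iff.2 fun x y hxy => ?_, ?_⟩
  · rw [map_act] at hxy ⊢
    exact h.1 _ _ hxy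
  · rw [cosetType_act, cosetType_act, h.2]
    congr 3
    rw [← Set.ncard_image_of_injective _ b.1.injective]
    congr 1
    ext x
    rw [Set.mem_sdiff, mem_dom_act, mem_dom_act]
    constructor
    · rintro ⟨y, hy, rfl⟩
      simpa using hy
    · intro hx
      exact ⟨b.1⁻¹ x, hx, by simp⟩

/-- The triple `(a, c, b)` acts on a composable pair by `(a α₁ c⁻¹, c α₂ b⁻¹)`. -/
def compAct (a c b : hyperoctahedral n) (p : Composable n) : Composable n :=
  ⟨(act a c p.1.1, act c b p.1.2), by
    ext x
    rw [mem_dom_act, mem_cod_act, p.2]⟩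

/-- `compAct` as a permutation. -/
def compPerm (a c b : hyperoctahedral n) : Equiv.Perm (Composable n) where
  toFun := compAct a c b
  invFun := compAct a⁻¹ c⁻¹ b⁻¹
  left_inv p :=
    Subtype.ext <| Prod.ext ((actPerm a c).left_inv p.1.1) ((actPerm c b).left_inv p.1.2)
  right_inv p :=
    Subtype.ext <| Prod.ext ((actPerm a c).right_inv p.1.1) ((actPerm c b).right_inv p.1.2)

/-- The middle element `c` cancels. This freedom allows the middle set to be moved while the
composition stays fixed. -/
theorem comp_compAct (a c b : hyperoctahedral n) (p : Composable n) :
    comp (compAct a c b p) = act a b (comp p) := by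
  refine PBij.ext (PEquiv.ext fun x => Option.ext fun y => ?_)
  rw [map_comp, map_act, map_comp]
  simp only [compAct, map_act]
  constructor
  · rintro ⟨z, h1, h2⟩
    exact ⟨_, h1, h2⟩
  · rintro ⟨z, h1, h2⟩
    exact ⟨c.1 z, by simpa using h1, by simpa using h2⟩

theorem compAct_mem_E {p : Composable n} (hp : p ∈ E α₁ α₂) (a c b : hyperoctahedral n) :
    compAct a c b p ∈ E (act a c α₁) (act c b α₂) := by
  obtain ⟨h1, h2, h3⟩ := mem_E.1 hp
  refine mem_E.2 ⟨h1.act a c, h2.act c b, ?_⟩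
  ext x
  rw [Set.mem_union, mem_dom_act, mem_cod_act]
  change x ∈ (act a c p.1.1).dom ↔ _
  rw [mem_dom_act, h3]
  rfl

theorem compAct_mem_E_iff {p : Composable n} (a c b : hyperoctahedral n) :
    compAct a c b p ∈ E (act a c α₁) (act c b α₂) ↔ p ∈ E α₁ α₂ := by
  refine ⟨fun h => ?_, fun h => compAct_mem_E h a c b⟩
  have := compAct_mem_E h a⁻¹ c⁻¹ b⁻¹
  have e : compAct a⁻¹ c⁻¹ b⁻¹ (compAct a c b p) = p := (compPerm a c b).left_inv p
  have e₁ : act a⁻¹ c⁻¹ (act a c α₁) = α₁ := (actPerm a c).left_inv α₁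
  have e₂ : act c⁻¹ b⁻¹ (act c b α₂) = α₂ := (actPerm c b).left_inv α₂
  rwa [e, e₁, e₂] at this

theorem card_E_act (a c b : hyperoctahedral n) :
    (E (act a c α₁) (act c b α₂)).card = (E α₁ α₂).card :=
  (Finset.card_equiv (compPerm a c b) fun _ => (compAct_mem_E_iff a c b).symm).symm

/-! ### Degrees -/

section Degrees

variable {p : Composable n}

variable (p) in
/-- The identification of the domain of `α₂` with the domain of `α₁`. -/
def midEquiv : p.1.2.dom ≃ p.1.1.dom := p.1.2.domEquiv.trans (Equiv.setCongr p.2.symm)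

theorem coe_midEquiv (x : p.1.2.dom) : (midEquiv p x : Pt) = p.1.2.app x := rfl

variable (p) in
/-- The index of the pair of the image of a point under the composition. -/
def final (x : p.1.2.dom) : ℕ := p.1.1.inner (midEquiv p x)

theorem isPairing_final : IsPairing (final p) := isPairing_inner.comp (midEquiv p)

/-- Transported to the domain of the second factor, the outer label of the first factor is the inner
label of the second. Thus all three coset-types live on one set. -/
theorem cosetType_fst : p.1.1.cosetType = cycleType p.1.2.inner (final p) :=
  (cycleType_congr (midEquiv p) (fun _ _ => Iff.rfl) fun _ _ => Iff.rfl).symm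

theorem cosetType_comp : (comp p).cosetType = cycleType p.1.2.outer (final p) := by
  have happ : ∀ x, (comp p).app x = p.1.1.app (midEquiv p (Equiv.setCongr (dom_comp p) x)) := by
    intro x
    refine app_eq_of_map (map_comp.2 ⟨_, map_eq_app (Equiv.setCongr (dom_comp p) x), ?_⟩)
    exact map_eq_app (midEquiv p (Equiv.setCongr (dom_comp p) x))
  refine cycleType_congr (Equiv.setCongr (dom_comp p)) (fun _ _ => Iff.rfl) fun x y => ?_
  rw [happ, happ]
  rfl

theorem card_cosetType_le_sum : Multiset.card α.cosetType ≤ α.cosetType.sum :=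
  isPairing_outer.card_cycleType_le isPairing_inner

theorem cosetType_sum_fst : p.1.1.cosetType.sum = (comp p).cosetType.sum := by
  rw [cosetType_sum_eq_card_domPairs, cosetType_sum_eq_card_domPairs, card_domPairs_fst]

theorem cosetType_sum_snd : p.1.2.cosetType.sum = (comp p).cosetType.sum := by
  rw [cosetType_sum_eq_card_domPairs, cosetType_sum_eq_card_domPairs,
    domPairs_congr (dom_comp p)]

theorem app_eq_of_le (h : α.map ≤ β.map) (x : α.dom) :
    α.app x = β.app ⟨x, dom_subset_of_le h x.2⟩ :=
  (app_eq_of_map (h _ _ (map_eq_app x))).symm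

/-- The middle set is exactly d₁ ∪ d₂'. A middle pair in d₁ on which the final label is constant is
a part 1 of `α₁`; one in d₂' on which the outer label is constant is a part 1 of `α₂`. -/
theorem ncard_common_le (hp : p ∈ E α₁ α₂) :
    {i | ∃ x, p.1.2.inner x = i ∧
        (∀ y, p.1.2.inner y = p.1.2.inner x → p.1.2.outer y = p.1.2.outer x) ∧
        ∀ y, p.1.2.inner y = p.1.2.inner x → final p y = final p x}.ncard ≤
      α₁.cosetType.count 1 + α₂.cosetType.count 1 := by
  obtain ⟨h1, h2, h3⟩ := mem_E.1 hp
  have hle1 := (isPairing_outer (α := α₁)).ncard_constant_le isPairing_inner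
  have hle2 := (isPairing_inner (α := α₂)).ncard_constant_le isPairing_outer
  rw [cycleType_comm] at hle2
  refine le_trans ?_ (add_le_add hle1 hle2)
  refine (Set.ncard_le_ncard ?_ ?_).trans (Set.ncard_union_le _ _)
  · rintro _ ⟨x, rfl, ho, hf⟩
    have hx : p.1.2.app x ∈ α₁.dom ∪ α₂.cod := by
      rw [← h3, ← coe_midEquiv]
      exact (midEquiv p x).2
    rcases hx with hx | hx
    · refine Or.inl ⟨⟨_, hx⟩, rfl, fun y hy => ?_⟩
      obtain ⟨z, hz⟩ := (midEquiv p).surjective ⟨y, dom_subset_of_le h1.1 y.2⟩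
      have hz' : p.1.2.app z = y := by rw [← coe_midEquiv, hz]
      have h4 := hf z (by
        change (p.1.2.app z).1 = _
        rw [hz']
        exact hy)
      change p.1.1.inner (midEquiv p z) = p.1.1.inner (midEquiv p x) at h4
      rw [hz] at h4
      unfold inner at h4 ⊢
      rw [app_eq_of_le h1.1, app_eq_of_le h1.1]
      exact h4
    · obtain ⟨u, hu⟩ := mem_cod.1 hx
      have hux : u = x := map_injective (h2.1 _ _ hu) (map_eq_app x)
      have hxd : x.1 ∈ α₂.dom := mem_dom.2 ⟨_, hux ▸ hu⟩
      have happ := app_eq_of_le h2.1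
      refine Or.inr ⟨⟨x.1, hxd⟩, ?_, fun y hy => ?_⟩
      · unfold inner
        rw [happ]
      · refine ho ⟨y.1, dom_subset_of_le h2.1 y.2⟩ ?_
        unfold inner at hy ⊢
        rwa [happ, happ] at hy
  · refine Set.Finite.union ?_ ?_
    · refine (Set.finite_range α₁.outer).subset ?_
      rintro _ ⟨x, rfl, -⟩
      exact ⟨x, rfl⟩
    · refine (Set.finite_range α₂.inner).subset ?_
      rintro _ ⟨x, rfl, -⟩
      exact ⟨x, rfl⟩

/-- Each added part 1 raises the size and the number of parts by one. -/
theorem IsTrivialExt.sum_sub_card (h : α.IsTrivialExt β) :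
    β.cosetType.sum - Multiset.card β.cosetType = α.cosetType.sum - Multiset.card α.cosetType := by
  rw [h.2, Multiset.sum_add, Multiset.card_add, Multiset.sum_replicate, Multiset.card_replicate,
    smul_eq_mul, mul_one, Nat.add_sub_add_right]

theorem cosetType_sum_comp_le (hp : p ∈ E α₁ α₂) :
    (comp p).cosetType.sum ≤ α₁.cosetType.sum + α₂.cosetType.sum := by
  simp only [cosetType_sum_eq_card_domPairs]
  rw [← card_domPairs_fst, domPairs_of_mem_E hp, ← card_codPairs (α := α₂)]
  exact Finset.card_union_le _ _

/-- The number `|ρ| - l(ρ)` is subadditive, with a defect `s` that accounts for the parts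
equal to `1` that do not come from the factors. -/
theorem exists_degree_correction (hp : p ∈ E α₁ α₂) :
    ∃ s, (comp p).cosetType.sum - Multiset.card (comp p).cosetType + s ≤
        (α₁.cosetType.sum - Multiset.card α₁.cosetType) +
          (α₂.cosetType.sum - Multiset.card α₂.cosetType) ∧
      (comp p).cosetType.count 1 ≤ s + (α₁.cosetType.count 1 + α₂.cosetType.count 1) := by
  obtain ⟨h1, h2, h3⟩ := mem_E.1 hp
  -- The defect is the number of two-element components of the composition that are not middle
  -- pairs.
  refine ⟨{c : (pairGraph p.1.2.outer (final p)).ConnectedComponent |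
    IsSplit p.1.2.inner c}.ncard, ?_, ?_⟩
  · have hc := card_components_add_le (π₁ := p.1.2.inner) (isPairing_outer (α := p.1.2))
      (isPairing_final (p := p))
    rw [← card_cycleType, ← card_cycleType, ← card_cycleType, ← cosetType_comp, ← cosetType_fst,
      ← isPairing_inner.sum_cycleType isPairing_outer, cycleType_comm p.1.2.inner,
      ← cosetType_eq] at hc
    rw [← h1.sum_sub_card, ← h2.sum_sub_card]
    have e1 := cosetType_sum_fst (p := p)
    have e2 := cosetType_sum_snd (p := p)
    -- These bounds ensure that none of the natural number subtractions truncates.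
    have l0 := card_cosetType_le_sum (α := comp p)
    have l1 := card_cosetType_le_sum (α := p.1.1)
    have l2 := card_cosetType_le_sum (α := p.1.2)
    omega
  · rw [cosetType_comp]
    exact (count_one_le isPairing_outer isPairing_inner isPairing_final).trans
      (Nat.add_le_add_left (ncard_common_le hp) _)

end Degrees

end PBij

section Product

variable {n : ℕ}

/-! ### Coefficients of a product -/

namespace PBij

variable {α β γ α₁ α₂ : PBij n}

variable (n) in
/-- Two partial bijections and a composable pair. -/
abbrev Triple : Type := PBij n × PBij n × Composable n

/-- The action of three elements of the hyperoctahedral group on triples. -/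
def triplePerm (a c b : hyperoctahedral n) : Equiv.Perm (Triple n) :=
  (actPerm a c).prodCongr ((actPerm c b).prodCongr (compPerm a c b))

open Classical in
/-- The contribution of a triple to the coefficient of `γ` in the product of `x` and `y`. -/
def weight (x y : PBAlg n) (γ : PBij n) (t : Triple n) : ℂ :=
  if t.2.2 ∈ E t.1 t.2.1 ∧ comp t.2.2 = γ then
    coeff x t.1 * coeff y t.2.1 * ((E t.1 t.2.1).card : ℂ)⁻¹ else 0

theorem weight_ne_zero {x y : PBAlg n} {t : Triple n} (h : weight x y γ t ≠ 0) :
    t.2.2 ∈ E t.1 t.2.1 ∧ comp t.2.2 = γ ∧ coeff x t.1 ≠ 0 ∧ coeff y t.2.1 ≠ 0 := by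
  unfold weight at h
  split_ifs at h with hc
  · exact ⟨hc.1, hc.2, left_ne_zero_of_mul (left_ne_zero_of_mul h),
      right_ne_zero_of_mul (left_ne_zero_of_mul h)⟩
  · exact absurd rfl h

theorem coeff_mul (x y : PBAlg n) (γ : PBij n) :
    coeff (x * y) γ = ∑ t : Triple n, weight x y γ t := by
  classical
  rw [mul_def, coeff_sum, Fintype.sum_prod_type]
  refine Finset.sum_congr rfl fun α _ => ?_
  rw [coeff_sum, Fintype.sum_prod_type]
  refine Finset.sum_congr rfl fun β _ => ?_
  rw [coeff_smul, starBasis, coeff_smul, coeff_sum]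
  simp only [coeff_basisVec, weight]
  rw [← mul_assoc, Finset.mul_sum, ← Finset.sum_subset (Finset.subset_univ (E α β))]
  · refine Finset.sum_congr rfl fun p hp => ?_
    simp [hp]
  · intro p _ hp
    simp [hp]

/-- Coefficients, membership in `E` and its cardinality are all equivariant, and `c` disappears from
the composition. With `a = b = 1` this says that moving the middle set keeps the contribution to the
same `γ`. -/
theorem weight_act {x y : PBAlg n} (hx : x ∈ AInv n) (hy : y ∈ AInv n) (a c b : hyperoctahedral n)
    (γ : PBij n) (t : Triple n) :
    weight x y (act a b γ) (triplePerm a c b t) = weight x y γ t := by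
  classical
  obtain ⟨α, β, p⟩ := t
  change weight x y (act a b γ) (act a c α, act c b β, compAct a c b p) = _
  have h : act a b (comp p) = act a b γ ↔ comp p = γ := (actPerm a b).injective.eq_iff
  have hc : (compAct a c b p ∈ E (act a c α) (act c b β) ∧ comp (compAct a c b p) = act a b γ) ↔
      p ∈ E α β ∧ comp p = γ := by
    rw [compAct_mem_E_iff, comp_compAct, h]
  simp only [weight, coeff_act hx, coeff_act hy, card_E_act]
  by_cases hq : p ∈ E α β ∧ comp p = γ
  · simp [hq, hc.2 hq]
  · simp [hq, mt hc.1 hq]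

theorem mul_mem_AInv {x y : PBAlg n} (hx : x ∈ AInv n) (hy : y ∈ AInv n) : x * y ∈ AInv n := by
  refine mem_AInv_of_coeff_act fun a b γ => ?_
  rw [coeff_mul, coeff_mul, ← Equiv.sum_comp (triplePerm a 1 b)]
  exact Finset.sum_congr rfl fun t _ => weight_act hx hy a 1 b γ t

/-! ### From `n` to `n + 1` -/

/-- The exchange of the `i`-th and the `n`-th pairs. -/
def swapPair (i : Fin (n + 1)) : hyperoctahedral (n + 1) :=
  pairPerm (Equiv.swap i.1 n) fun k hk => Equiv.swap_apply_of_ne_of_ne (by omega) (by omega)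

theorem swapPair_inv_apply (i : Fin (n + 1)) (x : Pt) :
    (swapPair i).1⁻¹ x = (Equiv.swap i.1 n x.1, x.2) := by
  rw [Equiv.Perm.inv_eq_iff_eq]
  exact Prod.ext (Equiv.swap_apply_self _ _ _).symm rfl

theorem mem_domPairs_act_swapPair {α : PBij (n + 1)} {a : hyperoctahedral (n + 1)}
    {i : Fin (n + 1)} : n ∈ (act a (swapPair i) α).domPairs ↔ i.1 ∈ α.domPairs := by
  rw [mem_domPairs (n, false), mem_domPairs (i.1, false), mem_dom_act, swapPair_inv_apply]
  simp

theorem mem_codPairs_act_swapPair {α : PBij (n + 1)} {b : hyperoctahedral (n + 1)}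
    {i : Fin (n + 1)} : n ∈ (act (swapPair i) b α).codPairs ↔ i.1 ∈ α.codPairs := by
  rw [mem_codPairs (n, false), mem_codPairs (i.1, false), mem_cod_act, swapPair_inv_apply]
  simp

theorem act_eq_self {a b : hyperoctahedral n} (ha : ∀ y ∈ α.cod, a.1 y = y)
    (hb : ∀ x ∈ α.dom, b.1 x = x) : act a b α = α := by
  refine ext_of_le (fun x y h => ?_) fun x hx => ?_
  · rw [map_act] at h
    have h1 := ha _ (mem_cod.2 ⟨_, h⟩)
    have h2 := hb _ (mem_dom.2 ⟨_, h⟩)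
    rw [← Equiv.Perm.mul_apply, mul_inv_cancel, Equiv.Perm.one_apply] at h1 h2
    rwa [← h1, ← h2] at h
  · rw [mem_dom_act]
    conv_rhs => rw [← hb x hx]
    simpa using hx

theorem dom_up : α.up.dom = α.dom := rfl

theorem cod_up : α.up.cod = α.cod := rfl

theorem domPairs_up : α.up.domPairs = α.domPairs := domPairs_congr dom_up

theorem codPairs_up : α.up.codPairs = α.codPairs := codPairs_congr cod_up

theorem notMem_domPairs : n ∉ α.domPairs := fun h =>
  (α.isPairUnion_dom.lt_of_mem_pairs h).false

theorem notMem_codPairs : n ∉ α.codPairs := fun h =>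
  (α.isPairUnion_cod.lt_of_mem_pairs h).false

theorem swapPair_apply_of_notMem {P : Set Pt} (hP : IsPairUnion n P) {i : Fin (n + 1)}
    (hi : i.1 ∉ hP.pairs) {x : Pt} (hx : x ∈ P) : (swapPair i).1 x = x := by
  refine Prod.ext (Equiv.swap_apply_of_ne_of_ne (fun h => hi ?_) (hP.lt x hx).ne) rfl
  rw [← h, hP.mem_pairs]
  exact hx

theorem up_injective : Function.Injective (up : PBij n → PBij (n + 1)) := fun α β h =>
  PBij.ext (show α.up.map = β.up.map by rw [h])

theorem exists_up_eq {α : PBij (n + 1)} (hd : n ∉ α.domPairs) (hc : n ∉ α.codPairs) :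
    ∃ β : PBij n, β.up = α := by
  refine ⟨⟨α.map, fun x hx => ?_, fun y hy => ?_, α.dom_pair, α.cod_pair⟩, rfl⟩
  · refine lt_of_le_of_ne (Nat.le_of_lt_succ (α.dom_lt x hx)) fun h => hd ?_
    have h' := (mem_domPairs x).2 hx
    rwa [h] at h'
  · refine lt_of_le_of_ne (Nat.le_of_lt_succ (α.cod_lt y hy)) fun h => hc ?_
    have h' := (mem_codPairs y).2 hy
    rwa [h] at h'

/-- A composable pair of partial bijections of `n` seen as a pair of partial bijections of
`n + 1`. -/
def compUp (p : Composable n) : Composable (n + 1) := ⟨(p.1.1.up, p.1.2.up), p.2⟩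

theorem compUp_injective : Function.Injective (compUp : Composable n → Composable (n + 1)) := by
  intro p q h
  have h' := congrArg Subtype.val h
  exact Subtype.ext (Prod.ext (up_injective (congrArg Prod.fst h'))
    (up_injective (congrArg Prod.snd h')))

theorem comp_compUp (p : Composable n) : comp (compUp p) = (comp p).up := rfl

theorem compUp_mem_E {p : Composable n} : compUp p ∈ E α₁.up α₂.up ↔ p ∈ E α₁ α₂ := by
  rw [mem_E, mem_E]
  exact Iff.rfl

theorem exists_compUp_eq {p : Composable (n + 1)} (h₁ : n ∉ p.1.1.codPairs)
    (h₂ : n ∉ p.1.2.domPairs) (h : n ∉ p.1.1.domPairs) : ∃ q, compUp q = p := by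
  have h' : n ∉ p.1.2.codPairs := by
    rwa [mem_domPairs (n, false), p.2, ← mem_codPairs] at h
  obtain ⟨β₁, hβ₁⟩ := exists_up_eq h h₁
  obtain ⟨β₂, hβ₂⟩ := exists_up_eq h₂ h'
  exact ⟨⟨(β₁, β₂), by rw [← dom_up, ← cod_up, hβ₁, hβ₂]; exact p.2⟩,
    Subtype.ext (Prod.ext hβ₁ hβ₂)⟩

open Classical in
theorem card_filter_notMem {D : Finset ℕ} (hD : ∀ k ∈ D, k < n + 1) :
    (Finset.univ.filter fun i : Fin (n + 1) => i.1 ∉ D).card = n + 1 - D.card := by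
  have h1 : (Finset.univ.filter fun i : Fin (n + 1) => i.1 ∈ D).card = D.card :=
    Finset.card_bij (fun i _ => i.1) (fun i hi => (Finset.mem_filter.1 hi).2)
      (fun i _ j _ h => Fin.ext h)
      fun k hk => ⟨⟨k, hD k hk⟩, Finset.mem_filter.2 ⟨Finset.mem_univ _, hk⟩, rfl⟩
  have h2 := Finset.card_filter_add_card_filter_not (s := Finset.univ)
    (fun i : Fin (n + 1) => i.1 ∈ D)
  rw [h1, Finset.card_univ, Fintype.card_fin] at h2
  omega

-- Exchanging `i` and `j` with the last pair `n` fixes `α₁` and `α₂`, because they avoid these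
-- pairs, and reduces the count to extensions that avoid `n`, that is, to extensions in `n`.
open Classical in
theorem card_E_up_filter {i j : Fin (n + 1)} (hi : i.1 ∉ α₁.codPairs) (hj : j.1 ∉ α₂.domPairs) :
    ((E α₁.up α₂.up).filter fun p => i.1 ∉ p.1.1.codPairs ∧ j.1 ∉ p.1.2.domPairs).card =
      (E α₁ α₂).card := by
  have h₁ : act (swapPair i) 1 α₁.up = α₁.up :=
    act_eq_self (fun y hy => swapPair_apply_of_notMem α₁.isPairUnion_cod hi hy) fun _ _ => rfl
  have h₂ : act 1 (swapPair j) α₂.up = α₂.up :=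
    act_eq_self (fun _ _ => rfl) fun x hx => swapPair_apply_of_notMem α₂.isPairUnion_dom hj hx
  have hl : ((E α₁.up α₂.up).filter fun p => n ∉ p.1.1.codPairs ∧ n ∉ p.1.2.domPairs).card =
      (E α₁ α₂).card := by
    symm
    refine Finset.card_bij (fun p _ => compUp p) (fun p hp => ?_)
      (fun p _ q _ h => compUp_injective h) fun p hp => ?_
    · exact Finset.mem_filter.2 ⟨compUp_mem_E.2 hp, notMem_codPairs (α := p.1.1) ∘ fun h => by
        rwa [← codPairs_up], notMem_domPairs (α := p.1.2) ∘ fun h => by rwa [← domPairs_up]⟩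
    · obtain ⟨hp, hc, hd⟩ := Finset.mem_filter.1 hp
      -- The middle set needs no condition: it is d₁ ∪ d₂', which never contains the pair `n`.
      obtain ⟨q, rfl⟩ := exists_compUp_eq hc hd (by
        rw [domPairs_of_mem_E hp, Finset.mem_union, domPairs_up, codPairs_up]
        exact fun h => h.elim notMem_domPairs notMem_codPairs)
      exact ⟨q, compUp_mem_E.1 hp, rfl⟩
  rw [← hl]
  refine Finset.card_equiv (compPerm (swapPair i) 1 (swapPair j)) fun p => ?_
  rw [Finset.mem_filter, Finset.mem_filter]
  change _ ↔ compAct _ _ _ p ∈ _ ∧ n ∉ (act (swapPair i) 1 p.1.1).codPairs ∧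
    n ∉ (act 1 (swapPair j) p.1.2).domPairs
  rw [mem_codPairs_act_swapPair, mem_domPairs_act_swapPair, ← compAct_mem_E_iff (swapPair i) 1
    (swapPair j), h₁, h₂]

/-- Double counting of the (p, i, j) where `i` avoids the codomain of the first extension and `j`
the domain of the second. Both sets have |d₁ ∪ d₂'| pairs, which gives the square on the left. For
fixed (i, j) the count is |E(α₁, α₂)| if `α₁` and `α₂` themselves avoid them, by `card_E_up_filter`,
and zero otherwise. -/
theorem card_E_up (α₁ α₂ : PBij n) :
    (E α₁.up α₂.up).card * (n + 1 - (α₁.domPairs ∪ α₂.codPairs).card) ^ 2 =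
      (n + 1 - α₁.domPairs.card) * (n + 1 - α₂.domPairs.card) * (E α₁ α₂).card := by
  classical
  have hlt : ∀ {m : ℕ} (α : PBij m), ∀ k ∈ α.domPairs, k < m := fun α k hk =>
    α.isPairUnion_dom.lt_of_mem_pairs hk
  have hlt' : ∀ {m : ℕ} (α : PBij m), ∀ k ∈ α.codPairs, k < m := fun α k hk =>
    α.isPairUnion_cod.lt_of_mem_pairs hk
  have key : ∀ p ∈ E α₁.up α₂.up, (n + 1 - (α₁.domPairs ∪ α₂.codPairs).card) ^ 2 =
      ∑ i : Fin (n + 1), ∑ j : Fin (n + 1),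
        if i.1 ∉ p.1.1.codPairs ∧ j.1 ∉ p.1.2.domPairs then 1 else 0 := by
    intro p hp
    have h1 := domPairs_of_mem_E hp
    rw [domPairs_up, codPairs_up] at h1
    have h2 : p.1.1.codPairs.card = (α₁.domPairs ∪ α₂.codPairs).card := by rw [card_codPairs, h1]
    have h3 : p.1.2.domPairs.card = (α₁.domPairs ∪ α₂.codPairs).card := by
      rw [← h1, card_domPairs_fst, domPairs_congr (dom_comp p)]
    have h4 := card_filter_notMem (hlt' p.1.1)
    have h5 := card_filter_notMem (hlt p.1.2)
    rw [h2] at h4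
    rw [h3] at h5
    rw [show (n + 1 - (α₁.domPairs ∪ α₂.codPairs).card) ^ 2 =
      (Finset.univ.filter fun i : Fin (n + 1) => i.1 ∉ p.1.1.codPairs).card *
        (Finset.univ.filter fun j : Fin (n + 1) => j.1 ∉ p.1.2.domPairs).card by rw [h4, h5, sq],
      Finset.card_filter, Finset.card_filter, Finset.sum_mul_sum]
    refine Finset.sum_congr rfl fun i _ => Finset.sum_congr rfl fun j _ => ?_
    by_cases hi : i.1 ∉ p.1.1.codPairs <;> by_cases hj : j.1 ∉ p.1.2.domPairs <;> simp [hi, hj]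
  rw [← smul_eq_mul, ← Finset.sum_const, Finset.sum_congr rfl key, Finset.sum_comm]
  simp_rw [Finset.sum_comm (s := E α₁.up α₂.up), ← Finset.card_filter]
  rw [← card_codPairs (α := α₁),
    ← card_filter_notMem (fun k hk => (hlt' α₁ k hk).trans n.lt_succ_self),
    ← card_filter_notMem (fun k hk => (hlt α₂ k hk).trans n.lt_succ_self),
    Finset.card_filter, Finset.card_filter, Finset.sum_mul_sum, Finset.sum_mul]
  refine Finset.sum_congr rfl fun i _ => ?_
  rw [Finset.sum_mul]
  refine Finset.sum_congr rfl fun j _ => ?_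
  by_cases hi : i.1 ∉ α₁.codPairs
  · by_cases hj : j.1 ∉ α₂.domPairs
    · rw [card_E_up_filter hi hj]
      simp [hi, hj]
    · simp only [hj, if_false, mul_zero, zero_mul, Finset.card_eq_zero]
      refine Finset.filter_eq_empty_iff.2 fun p hp h => h.2 ?_
      rw [not_not, mem_domPairs (j.1, false)] at hj
      rw [mem_domPairs (j.1, false)]
      exact dom_subset_of_le (mem_E.1 hp).2.1.1 hj
  · simp only [hi, if_false, zero_mul, Finset.card_eq_zero]
    refine Finset.filter_eq_empty_iff.2 fun p hp h => h.1 ?_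
    rw [not_not, mem_codPairs (i.1, false)] at hi
    rw [mem_codPairs (i.1, false)]
    exact cod_subset_of_le (mem_E.1 hp).1.1 hi

end PBij

end Product

section Limit

variable {n : ℕ}

open PBij

/-! ### The projection maps are multiplicative -/

theorem coeff_phi (z : PBAlg (n + 1)) (γ : PBij n) :
    coeff (phi n z) γ =
      ((n : ℂ) + 1) / ((n : ℂ) + 1 - (γ.domPairs.card : ℕ)) * coeff z γ.up := by
  classical
  change coeff (∑ α : PBij n, (((n : ℂ) + 1) / ((n : ℂ) + 1 - (α.cosetType.sum : ℕ)) *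
    coeff z α.up) • basisVec α) γ = _
  simp [coeff_sum, coeff_basisVec, cosetType_sum_eq_card_domPairs]

theorem natCast_sub_card_ne_zero (α : PBij n) : (n : ℂ) + 1 - (α.domPairs.card : ℕ) ≠ 0 := by
  have := α.card_domPairs_le
  rw [sub_ne_zero]
  exact_mod_cast (show n + 1 ≠ α.domPairs.card by omega)

-- Averaging over the middle set: for each `i`, the triples whose middle set avoids `i` contribute
-- as much as those that avoid `n`, and each contributing triple avoids exactly `n + 1 - |γ|`
-- indices.
open Classical in
theorem sum_weight_eq {x y : PBAlg (n + 1)} (hx : x ∈ AInv (n + 1)) (hy : y ∈ AInv (n + 1))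
    (γ : PBij n) :
    ((n : ℂ) + 1 - (γ.domPairs.card : ℕ)) * ∑ t : Triple (n + 1), weight x y γ.up t =
      ((n : ℂ) + 1) * ∑ t : Triple (n + 1),
        if n ∉ t.2.2.1.1.domPairs then weight x y γ.up t else 0 := by
  have hswap : ∀ i : Fin (n + 1),
      ∑ t : Triple (n + 1), (if i.1 ∉ t.2.2.1.1.domPairs then weight x y γ.up t else 0) =
        ∑ t : Triple (n + 1), if n ∉ t.2.2.1.1.domPairs then weight x y γ.up t else 0 := by
    intro i
    rw [← Equiv.sum_comp (triplePerm 1 (swapPair i) 1) fun t : Triple (n + 1) =>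
      if n ∉ t.2.2.1.1.domPairs then weight x y γ.up t else 0]
    refine Finset.sum_congr rfl fun t _ => ?_
    have h1 := weight_act hx hy 1 (swapPair i) 1 γ.up t
    rw [act_one] at h1
    have h2 : n ∉ ((triplePerm 1 (swapPair i) 1) t).2.2.1.1.domPairs ↔
        i.1 ∉ t.2.2.1.1.domPairs := not_congr mem_domPairs_act_swapPair
    simp only [h1, h2]
  have hcount : ∀ t : Triple (n + 1),
      ∑ i : Fin (n + 1), (if i.1 ∉ t.2.2.1.1.domPairs then weight x y γ.up t else 0) =
        ((n : ℂ) + 1 - (γ.domPairs.card : ℕ)) * weight x y γ.up t := by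
    intro t
    by_cases ht : weight x y γ.up t = 0
    · simp [ht]
    · obtain ⟨-, hc, -⟩ := weight_ne_zero ht
      -- The middle set has as many pairs as the domain of the composition.
      have hcard : t.2.2.1.1.domPairs.card = γ.domPairs.card := by
        rw [card_domPairs_fst, hc, domPairs_up]
      have hf := card_filter_notMem (n := n) (D := t.2.2.1.1.domPairs)
        fun k hk => t.2.2.1.1.isPairUnion_dom.lt_of_mem_pairs hk
      rw [hcard] at hf
      rw [← Finset.sum_filter, Finset.sum_const, hf, nsmul_eq_mul,
        Nat.cast_sub (γ.card_domPairs_le.trans n.le_succ)]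
      push_cast
      rfl
  rw [Finset.mul_sum, ← Finset.sum_congr rfl fun t _ => hcount t, Finset.sum_comm,
    Finset.sum_congr rfl fun i _ => hswap i]
  simp

/-- A triple of `n` seen as a triple of `n + 1`. -/
def tripleUp (t : Triple n) : Triple (n + 1) := (t.1.up, t.2.1.up, compUp t.2.2)

theorem tripleUp_injective : Function.Injective (tripleUp : Triple n → Triple (n + 1)) := by
  rintro ⟨α, β, p⟩ ⟨α', β', p'⟩ h
  simp only [tripleUp, Prod.mk.injEq] at h
  rw [up_injective h.1, up_injective h.2.1, compUp_injective h.2.2]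

theorem exists_tripleUp_eq {γ : PBij n} {t : Triple (n + 1)} (ht : t.2.2 ∈ E t.1 t.2.1)
    (hc : comp t.2.2 = γ.up) (hn : n ∉ t.2.2.1.1.domPairs) : ∃ s, tripleUp s = t := by
  obtain ⟨α, β, p⟩ := t
  obtain ⟨h1, h2, -⟩ := mem_E.1 ht
  obtain ⟨q, rfl⟩ := exists_compUp_eq (p := p)
    (by
      rw [codPairs_congr (cod_comp p).symm, hc, codPairs_up]
      exact notMem_codPairs)
    (by
      rw [domPairs_congr (dom_comp p).symm, hc, domPairs_up]
      exact notMem_domPairs) hn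
  have key : ∀ {δ : PBij (n + 1)} {ε : PBij n}, δ.IsTrivialExt ε.up → ∃ δ', up δ' = δ := by
    intro δ ε h
    refine exists_up_eq (fun hd => ?_) fun hd => ?_
    · rw [mem_domPairs (n, false)] at hd
      exact (ε.dom_lt _ (dom_subset_of_le h.1 hd)).false
    · rw [mem_codPairs (n, false)] at hd
      exact (ε.cod_lt _ (cod_subset_of_le h.1 hd)).false
  obtain ⟨α', rfl⟩ := key (ε := q.1.1) h1
  obtain ⟨β', rfl⟩ := key (ε := q.1.2) h2
  exact ⟨(α', β', q), rfl⟩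

/-- For a contributing triple |d₁ ∪ d₂'| = |γ|, so `card_E_up` turns the factors of `phi` at `α` and
`β` into a square that depends only on `γ`. -/
theorem weight_phi (x y : PBAlg (n + 1)) (γ : PBij n) (t : Triple n) :
    weight (phi n x) (phi n y) γ t =
      (((n : ℂ) + 1) / ((n : ℂ) + 1 - (γ.domPairs.card : ℕ))) ^ 2 *
        weight x y γ.up (tripleUp t) := by
  classical
  obtain ⟨α, β, p⟩ := t
  have hc : (compUp p ∈ E α.up β.up ∧ comp (compUp p) = γ.up) ↔ p ∈ E α β ∧ comp p = γ := by
    rw [compUp_mem_E, comp_compUp, up_injective.eq_iff]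
  by_cases hq : p ∈ E α β ∧ comp p = γ
  · simp only [weight, tripleUp, hq, hc.2 hq, and_self, if_true, coeff_phi]
    have hr : (α.domPairs ∪ β.codPairs).card = γ.domPairs.card := by
      rw [← domPairs_of_mem_E hq.1, card_domPairs_fst, hq.2]
    have hE := card_E_up α β
    rw [hr] at hE
    have hsub : ∀ δ : PBij n, ((n + 1 - δ.domPairs.card : ℕ) : ℂ) =
        (n : ℂ) + 1 - (δ.domPairs.card : ℕ) := fun δ => by
      rw [Nat.cast_sub (δ.card_domPairs_le.trans n.le_succ)]
      push_cast
      rfl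
    have hE' := congrArg (Nat.cast : ℕ → ℂ) hE
    simp only [Nat.cast_mul, Nat.cast_pow, hsub] at hE'
    have h1 := natCast_sub_card_ne_zero α
    have h2 := natCast_sub_card_ne_zero β
    have h3 := natCast_sub_card_ne_zero γ
    have hE0 : ((E α β).card : ℂ) ≠ 0 := by
      exact_mod_cast (Finset.card_pos.2 ⟨p, hq.1⟩).ne'
    have hE1 : ((E α.up β.up).card : ℂ) ≠ 0 := by
      exact_mod_cast (Finset.card_pos.2 ⟨_, (hc.2 hq).1⟩).ne'
    generalize ((n : ℂ) + 1 - (α.domPairs.card : ℕ)) = u at *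
    generalize ((n : ℂ) + 1 - (β.domPairs.card : ℕ)) = v at *
    generalize ((n : ℂ) + 1 - (γ.domPairs.card : ℕ)) = w at *
    field_simp
    linear_combination (coeff x α.up * coeff y β.up) * hE'
  · have hq' := mt hc.1 hq
    simp only [weight, tripleUp, hq, hq', if_false, mul_zero]

/-- The factor `(n+1)/(n+1-|γ|)` appears squared on the right by `weight_phi`. On the left it
appears once in `phi` and once more through `sum_weight_eq`, when the sum is restricted to triples
that avoid the last pair. -/
theorem phi_mul {x y : PBAlg (n + 1)} (hx : x ∈ AInv (n + 1)) (hy : y ∈ AInv (n + 1)) :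
    phi n (x * y) = phi n x * phi n y := by
  classical
  refine PBAlg.ext fun γ => ?_
  rw [coeff_phi, coeff_mul, coeff_mul, Finset.sum_congr rfl fun t _ => weight_phi x y γ t,
    ← Finset.mul_sum]
  -- The domain and codomain of `γ.up` avoid `n`, so a contributing triple comes from level `n` as
  -- soon as its middle set avoids `n`.
  have h1 : ∑ t : Triple n, weight x y γ.up (tripleUp t) = ∑ t : Triple (n + 1),
      if n ∉ t.2.2.1.1.domPairs then weight x y γ.up t else 0 := by
    refine Finset.sum_of_injOn tripleUp tripleUp_injective.injOn (fun _ _ => Finset.mem_univ _)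
      (fun t _ ht => ?_) fun t _ => ?_
    · by_contra hne
      rw [ite_eq_right_iff, Classical.not_imp] at hne
      obtain ⟨hE, hc, -⟩ := weight_ne_zero hne.2
      obtain ⟨s, hs⟩ := exists_tripleUp_eq hE hc hne.1
      exact ht ⟨s, Finset.mem_coe.2 (Finset.mem_univ _), hs⟩
    · rw [if_pos]
      change n ∉ t.2.2.1.1.up.domPairs
      rw [domPairs_up]
      exact notMem_domPairs
  have h2 := sum_weight_eq hx hy γ
  have h3 := natCast_sub_card_ne_zero γ
  rw [h1]
  field_simp
  rw [mul_comm] at h2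
  linear_combination h2

theorem mul_mem_AInfty {a b : Seq} (ha : a ∈ AInfty) (hb : b ∈ AInfty) : a * b ∈ AInfty :=
  ⟨fun n => mul_mem_AInv (ha.1 n) (hb.1 n), fun n => by
    rw [Pi.mul_apply, phi_mul (ha.1 _) (hb.1 _), ha.2, hb.2]
    rfl⟩

/-! ### Existence of partial bijections with a given coset-type -/

section Existence

/-- A rotation. The value at the last point is left unspecified, since a path through the block
already makes it connected. -/
theorem exists_perm_fin_succ (k : ℕ) :
    ∃ r : Equiv.Perm (Fin k), ∀ j (h : j + 1 < k), r ⟨j, by omega⟩ = ⟨j + 1, h⟩ := by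
  cases k with
  | zero => exact ⟨1, fun j h => absurd h (by omega)⟩
  | succ k => exact ⟨finRotate (k + 1), fun j h => finRotate_of_lt (by omega)⟩

/-- The partial bijection with domain and codomain `[2n]` given by a permutation. -/
def ofPerm (w : Equiv.Perm Pt) (hw : ∀ x, (w x).1 < n ↔ x.1 < n) : PBij n :=
  have hm : ∀ x y, ((PEquiv.ofSet {x : Pt | x.1 < n}).trans w.toPEquiv) x = some y ↔
      x.1 < n ∧ w x = y := by
    intro x y
    rw [PEquiv.trans_eq_some]
    simp only [PEquiv.ofSet_eq_some_iff, Equiv.toPEquiv_apply, Option.some.injEq]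
    constructor
    · rintro ⟨z, ⟨rfl, h⟩, h'⟩
      exact ⟨h, h'⟩
    · rintro ⟨h, h'⟩
      exact ⟨x, ⟨rfl, h⟩, h'⟩
  have hd : ∀ x, (((PEquiv.ofSet {x : Pt | x.1 < n}).trans w.toPEquiv) x).isSome ↔ x.1 < n := by
    intro x
    simp only [Option.isSome_iff_exists, hm]
    exact ⟨fun ⟨_, h, _⟩ => h, fun h => ⟨_, h, rfl⟩⟩
  have hc : ∀ y, (((PEquiv.ofSet {x : Pt | x.1 < n}).trans w.toPEquiv).symm y).isSome ↔
      y.1 < n := by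
    intro y
    refine (Option.isSome_iff_exists.trans (exists_congr fun x =>
      (PEquiv.eq_some_iff _).trans (hm x y))).trans ?_
    constructor
    · rintro ⟨x, h, rfl⟩
      exact (hw x).2 h
    · intro h
      exact ⟨w.symm y, (hw _).1 (by simpa using h), by simp⟩
  { map := (PEquiv.ofSet {x : Pt | x.1 < n}).trans w.toPEquiv
    dom_lt := fun x => (hd x).1
    cod_lt := fun y => (hc y).1
    dom_pair := fun k b b' h => (hd (k, b')).2 ((hd (k, b)).1 h)
    cod_pair := fun k b b' h => (hc (k, b')).2 ((hc (k, b)).1 h) }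

theorem map_ofPerm {w : Equiv.Perm Pt} {hw : ∀ x, (w x).1 < n ↔ x.1 < n} {x : Pt} (hx : x.1 < n) :
    (ofPerm w hw).map x = some (w x) := by
  change ((PEquiv.ofSet {x : Pt | x.1 < n}).trans w.toPEquiv) x = _
  rw [PEquiv.trans_eq_some]
  exact ⟨x, by simpa [PEquiv.ofSet_eq_some_iff] using hx, rfl⟩

theorem dom_ofPerm {w : Equiv.Perm Pt} {hw : ∀ x, (w x).1 < n ↔ x.1 < n} :
    (ofPerm w hw).dom = {x | x.1 < n} :=
  Set.ext fun x => ⟨(ofPerm w hw).dom_lt x, fun hx => mem_dom.2 ⟨_, map_ofPerm hx⟩⟩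

/-- The permutation that acts by `q` on the second elements of the pairs. -/
def shear (q : Equiv.Perm ℕ) : Equiv.Perm Pt where
  toFun x := (bif x.2 then q x.1 else x.1, x.2)
  invFun x := (bif x.2 then q.symm x.1 else x.1, x.2)
  left_inv := by rintro ⟨k, _ | _⟩ <;> simp
  right_inv := by rintro ⟨k, _ | _⟩ <;> simp

/-- The first label joins the two copies of a position, and the second joins the `true` copy of `j`
to the `false` copy of `j + 1`, so block `i` is connected with `2 * l i` points. Neither label
leaves a block, as `r` acts blockwise and `f` is injective. -/
theorem cycleType_sigma {s : ℕ} (l : Fin s → ℕ) (hl : ∀ i, 0 < l i)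
    (r : ∀ i, Equiv.Perm (Fin (l i)))
    (hr : ∀ i j (h : j + 1 < l i), r i ⟨j, by omega⟩ = ⟨j + 1, h⟩)
    (f : (Σ i, Fin (l i)) → ℕ) (hf : Function.Injective f) :
    cycleType (X := (Σ i, Fin (l i)) × Bool) (fun u => f u.1)
      (fun u => bif u.2 then f ⟨u.1.1, r u.1.1 u.1.2⟩ else f u.1) =
      (Finset.univ : Finset (Fin s)).val.map l := by
  set π : (Σ i, Fin (l i)) × Bool → ℕ := fun u => f u.1 with hπ
  set π' : (Σ i, Fin (l i)) × Bool → ℕ :=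
    fun u => bif u.2 then f ⟨u.1.1, r u.1.1 u.1.2⟩ else f u.1 with hπ'
  have hzero : ∀ i j (h : j < l i),
      (pairGraph π π').Reachable (⟨i, ⟨0, hl i⟩⟩, false) (⟨i, ⟨j, h⟩⟩, false) := by
    intro i j
    induction j with
    | zero => exact fun h => SimpleGraph.Reachable.refl _
    | succ j ih =>
      intro h
      let y : (Σ i, Fin (l i)) × Bool := (⟨i, ⟨j, by omega⟩⟩, true)
      have h1 : (pairGraph π π').Reachable (⟨i, ⟨j, by omega⟩⟩, false) y := reachable_of_left rfl
      have h2 : (pairGraph π π').Reachable y (⟨i, ⟨j + 1, h⟩⟩, false) := by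
        refine reachable_of_right ?_
        simp only [y, hπ', cond_true, cond_false]
        rw [hr i j h]
      exact ((ih (by omega)).trans h1).trans h2
  have hbase : ∀ u : (Σ i, Fin (l i)) × Bool,
      (pairGraph π π').Reachable (⟨u.1.1, ⟨0, hl u.1.1⟩⟩, false) u := fun u =>
    (hzero u.1.1 u.1.2.1 u.1.2.2).trans (reachable_of_left rfl)
  have hlabel : ∀ u, ∃ a, π' u = f ⟨u.1.1, a⟩ := by
    rintro ⟨⟨i, a⟩, _ | _⟩
    · exact ⟨a, rfl⟩
    · exact ⟨r i a, rfl⟩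
  have hfst : ∀ u v, (pairGraph π π').Reachable u v ↔ u.1.1 = v.1.1 := by
    intro u v
    constructor
    · intro h
      refine Reachable.induction (P := fun v => u.1.1 = v.1.1) h rfl (fun v w hv hvw => ?_)
        fun v w hv hvw => ?_
      · rw [hv, hf hvw]
      · rw [hv]
        obtain ⟨a, ha⟩ := hlabel v
        obtain ⟨b, hb⟩ := hlabel w
        rw [ha, hb] at hvw
        have h := hf hvw
        exact (Sigma.mk.inj h).1
    · intro h
      have h1 := hbase u
      have h2 := hbase v
      obtain ⟨⟨i, a⟩, b⟩ := u
      obtain ⟨⟨j, c⟩, d⟩ := v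
      obtain rfl : i = j := h
      exact h1.symm.trans h2
  let φ : Fin s → (pairGraph π π').ConnectedComponent := fun i =>
    (pairGraph π π').connectedComponentMk (⟨i, ⟨0, hl i⟩⟩, false)
  have hφ : Function.Bijective φ := by
    constructor
    · intro i j hij
      exact (hfst _ _).1 (SimpleGraph.ConnectedComponent.eq.1 hij)
    · intro c
      induction c using SimpleGraph.ConnectedComponent.ind with
      | h u => exact ⟨u.1.1, SimpleGraph.ConnectedComponent.eq.2 (hbase u)⟩
  have hsize : ∀ i, halfSize (φ i) = l i := by
    intro i
    let g : Fin (l i) × Bool → (Σ i, Fin (l i)) × Bool := fun u => (⟨i, u.1⟩, u.2)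
    have hg : Function.Injective g := by
      rintro ⟨a, b⟩ ⟨c, d⟩ h
      simpa [g] using h
    have hs : (φ i).supp = Set.range g := by
      ext u
      rw [SimpleGraph.ConnectedComponent.mem_supp_iff, SimpleGraph.ConnectedComponent.eq, hfst]
      constructor
      · intro h
        obtain ⟨⟨j, c⟩, d⟩ := u
        obtain rfl : j = i := h
        exact ⟨(c, d), rfl⟩
      · rintro ⟨v, rfl⟩
        rfl
    rw [halfSize, hs, ← Set.image_univ, Set.ncard_image_of_injective _ hg, Set.ncard_univ]
    simp
  rw [cycleType, ← Finset.map_univ_equiv (Equiv.ofBijective φ hφ), Finset.map_val,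
    Multiset.map_map]
  exact Multiset.map_congr rfl fun i _ => hsize i

/-- Every partition of `m` is the coset-type of a partial bijection of `m`. -/
theorem exists_cosetType_eq (r : Ptn) : ∃ α : PBij r.1, α.cosetType = r.2.parts := by
  classical
  obtain ⟨m, p⟩ := r
  let L := p.parts.toList
  let l : Fin L.length → ℕ := L.get
  have hl : ∀ i, 0 < l i := fun i =>
    p.parts_pos (Multiset.mem_toList.1 (List.get_mem L i))
  have hmap : (Finset.univ : Finset (Fin L.length)).val.map l = p.parts := by
    rw [Fin.univ_val_map, List.ofFn_get, Multiset.coe_toList]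
  have hcard : Fintype.card (Σ i, Fin (l i)) = Fintype.card (Fin m) := by
    rw [Fintype.card_sigma, Fintype.card_fin]
    simp only [Fintype.card_fin]
    rw [← Finset.sum_map_val, hmap, p.parts_sum]
  let f : (Σ i, Fin (l i)) ≃ Fin m := Fintype.equivOfCardEq hcard
  choose r hr using fun i => exists_perm_fin_succ (l i)
  -- One rotation for each part, transported to the first `m` indices and extended by the identity.
  -- Applying it to one element of each pair turns every rotation into a cycle of the graph.
  let q : Equiv.Perm ℕ :=
    (f.permCongr (Equiv.sigmaCongrRight r)).extendDomain Fin.equivSubtype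
  have hq : ∀ u, q (f u) = f ⟨u.1, r u.1 u.2⟩ := by
    intro u
    have := Equiv.Perm.extendDomain_apply_image (f.permCongr (Equiv.sigmaCongrRight r))
      (Fin.equivSubtype (n := m)) (f u)
    refine this.trans ?_
    rw [Equiv.permCongr_apply, Equiv.symm_apply_apply]
    rfl
  have hqlt : ∀ k, q k < m ↔ k < m := by
    intro k
    by_cases hk : k < m
    · obtain ⟨u, hu⟩ := f.surjective ⟨k, hk⟩
      have h := hq u
      rw [hu] at h
      simp only at h
      rw [h]
      simp [hk]
    · have : q k = k := Equiv.Perm.extendDomain_apply_not_subtype (p := (· < m)) _ _ hk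
      rw [this]
  have hw : ∀ x, (shear q x).1 < m ↔ x.1 < m := by
    rintro ⟨k, _ | _⟩
    · rfl
    · exact hqlt k
  refine ⟨ofPerm (shear q) hw, ?_⟩
  have hmem : ∀ u : (Σ i, Fin (l i)) × Bool, ((f u.1 : ℕ), u.2) ∈ (ofPerm (shear q) hw).dom :=
    fun u => dom_ofPerm.symm ▸ (f u.1).2
  let e : (Σ i, Fin (l i)) × Bool ≃ (ofPerm (shear q) hw).dom :=
    Equiv.ofBijective (fun u => ⟨_, hmem u⟩) <| by
      constructor
      · rintro ⟨u, b⟩ ⟨v, c⟩ h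
        simp only [Subtype.mk.injEq, Prod.mk.injEq, Fin.val_inj, EmbeddingLike.apply_eq_iff_eq] at h
        exact Prod.ext h.1 h.2
      · rintro ⟨⟨k, b⟩, hk⟩
        obtain ⟨u, hu⟩ := f.surjective ⟨k, (ofPerm (shear q) hw).dom_lt _ hk⟩
        exact ⟨(u, b), Subtype.ext (Prod.ext (by simp [hu]) rfl)⟩
  have happ : ∀ u, (ofPerm (shear q) hw).inner (e u) =
      bif u.2 then (f ⟨u.1.1, r u.1.1 u.1.2⟩ : ℕ) else f u.1 := by
    rintro ⟨u, b⟩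
    have h1 : (ofPerm (shear q) hw).app (e (u, b)) = shear q (f u, b) :=
      app_eq_of_map (map_ofPerm (f u).2)
    change ((ofPerm (shear q) hw).app (e (u, b))).1 = _
    rw [h1, ← hq]
    rfl
  rw [cosetType_eq, ← hmap, ← cycleType_sigma l hl r hr (fun u => (f u : ℕ))
    (Fin.val_injective.comp f.injective)]
  refine (cycleType_congr e (fun _ _ => Iff.rfl) fun u v => ?_).symm
  rw [happ, happ]

end Existence

/-! ### Elements of the projective limit -/

theorem Ptn.ext_parts {r r' : Ptn} (h : r.2.parts = r'.2.parts) : r = r' := by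
  obtain ⟨m, p⟩ := r
  obtain ⟨m', p'⟩ := r'
  obtain rfl : m = m' := by rw [← p.parts_sum, ← p'.parts_sum, h]
  exact congrArg _ (Nat.Partition.ext h)

/-- The coset-type as a partition. -/
def cosetPtn (α : PBij n) : Ptn := ⟨_, α.cosetType, fun h => cosetType_pos h, rfl⟩

theorem coeff_T (r : Ptn) (n : ℕ) (α : PBij n) [Decidable (cosetPtn α = r)] :
    coeff (T r n) α = if cosetPtn α = r then (n.choose r.1 : ℂ)⁻¹ else 0 := by
  classical
  have h : cosetPtn α = r ↔ α.cosetType = r.2.parts :=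
    ⟨fun h => h ▸ rfl, fun h => Ptn.ext_parts h⟩
  unfold T
  split_ifs with h1 h2 h2
  -- No partial bijection of `n` has a coset-type of size greater than `n`, which agrees with the
  -- value 0 of `T` there.
  · exact absurd (h2 ▸ α.cosetType_sum_le : r.1 ≤ n) (not_le.2 h1)
  · rfl
  · rw [coeff_smul, coeff_S, if_pos (h.1 h2), mul_one]
  · rw [coeff_smul, coeff_S, if_neg fun h' => h2 (h.2 h'), mul_zero]

theorem coeff_infComb (x : Ptn → ℂ) (n : ℕ) (α : PBij n) :
    coeff (infComb x n) α = x (cosetPtn α) * (n.choose (cosetPtn α).1 : ℂ)⁻¹ := by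
  classical
  simp only [infComb, coeff_sum, coeff_smul, coeff_T]
  rw [Finset.sum_sigma', Finset.sum_eq_single (cosetPtn α)]
  · simp
  · intro r _ hr
    rw [if_neg fun h => hr h.symm, mul_zero]
  · intro h
    refine (h ?_).elim
    rw [Finset.mem_sigma]
    exact ⟨Finset.mem_range.2 (Nat.lt_succ_of_le α.cosetType_sum_le), Finset.mem_univ _⟩

/-- A partial bijection of `|r|` with coset-type `r`. -/
def full (r : Ptn) : PBij r.1 := (exists_cosetType_eq r).choose

theorem cosetType_full (r : Ptn) : (full r).cosetType = r.2.parts :=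
  (exists_cosetType_eq r).choose_spec

theorem cosetPtn_full (r : Ptn) : cosetPtn (full r) = r := Ptn.ext_parts (cosetType_full r)

/-- Every element of the projective limit is an infinite linear combination of the `T r`. -/
theorem eq_infComb {a : Seq} (ha : a ∈ AInfty) :
    a = infComb fun r => coeff (a r.1) (full r) := by
  -- Compatibility with `phi` and the identity C(n,k)(n+1) = C(n+1,k)(n+1-k) show that the
  -- coefficient multiplied by C(n,|r|) does not depend on `n`. It suffices to follow one partial
  -- bijection, regarded as living in larger and larger `n`.
  have key : ∀ (r : Ptn) (n : ℕ), r.1 ≤ n → ∃ β : PBij n, β.cosetType = r.2.parts ∧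
      coeff (a n) β = coeff (a r.1) (full r) * (n.choose r.1 : ℂ)⁻¹ := by
    intro r n hn
    induction n, hn using Nat.le_induction with
    | base => exact ⟨full r, cosetType_full r, by simp⟩
    | succ n hn ih =>
      obtain ⟨β, hβ, h⟩ := ih
      refine ⟨β.up, hβ, ?_⟩
      rw [← ha.2 n, coeff_phi, ← cosetType_sum_eq_card_domPairs, hβ, r.2.parts_sum] at h
      have h1 : (n : ℂ) + 1 ≠ 0 := by exact_mod_cast n.succ_ne_zero
      have h2 : ((n + 1).choose r.1 : ℂ) ≠ 0 := by
        exact_mod_cast (Nat.choose_pos (hn.trans n.le_succ)).ne'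
      have h3 : (n.choose r.1 : ℂ) ≠ 0 := by exact_mod_cast (Nat.choose_pos hn).ne'
      have h4 : (n : ℂ) + 1 - (r.1 : ℕ) ≠ 0 := by
        rw [sub_ne_zero]
        exact_mod_cast (show n + 1 ≠ r.1 by omega)
      have h5 : (n.choose r.1 : ℂ) * (n + 1) = (n + 1).choose r.1 * ((n : ℂ) + 1 - (r.1 : ℕ)) := by
        have := congrArg (Nat.cast : ℕ → ℂ) (Nat.choose_mul_succ_eq n r.1)
        rw [Nat.cast_mul, Nat.cast_mul, Nat.cast_sub (hn.trans n.le_succ)] at this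
        exact_mod_cast this
      field_simp at h ⊢
      have h6 : (n.choose r.1 : ℂ) * (n + 1) ≠ 0 := mul_ne_zero h3 h1
      refine mul_right_cancel₀ h4 ?_
      linear_combination h - coeff (a (n + 1)) β.up * h5
  funext n
  refine PBAlg.ext fun α => ?_
  rw [coeff_infComb]
  obtain ⟨β, hβ, h⟩ := key (cosetPtn α) n α.cosetType_sum_le
  rw [← h]
  exact coeff_eq_of_cosetType_eq (ha.1 n) hβ.symm

theorem T_mem_AInfty (r : Ptn) : T r ∈ AInfty := by
  refine ⟨fun n => ?_, fun n => ?_⟩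
  · unfold T
    split_ifs
    · exact zero_mem _
    · exact (AInv n).smul_mem _ (S_mem_AInv r n)
  · unfold T
    rcases lt_trichotomy (n + 1) r.1 with h | h | h
    · rw [if_pos h, if_pos (n.lt_succ_self.trans h), map_zero]
    -- At n + 1 = |r| the map `phi` kills `S r (n + 1)`, in agreement with the vanishing term of
    -- index `n`.
    · rw [if_neg (by omega), if_pos (by omega), map_smul, phi_S r n h.ge, if_neg (by omega),
        smul_zero]
    · rw [if_neg (by omega), if_neg (by omega), map_smul, phi_S r n h.le, if_pos h, smul_smul]
      congr 1
      have h2 : ((n + 1).choose r.1 : ℂ) ≠ 0 := by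
        exact_mod_cast (Nat.choose_pos h.le).ne'
      have h3 : (n.choose r.1 : ℂ) ≠ 0 := by
        exact_mod_cast (Nat.choose_pos (Nat.le_of_lt_succ h)).ne'
      have h4 : (n : ℂ) + 1 - (r.1 : ℕ) ≠ 0 := by
        rw [sub_ne_zero]
        exact_mod_cast (show n + 1 ≠ r.1 by omega)
      have h5 := congrArg (Nat.cast : ℕ → ℂ) (Nat.choose_mul_succ_eq n r.1)
      rw [Nat.cast_mul, Nat.cast_mul, Nat.cast_sub h.le] at h5
      push_cast at h5
      field_simp
      linear_combination h5

theorem T_eq_infComb (r : Ptn) [DecidableEq Ptn] : T r = infComb (Pi.single r 1) := by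
  funext n
  refine PBAlg.ext fun α => ?_
  rw [coeff_T, coeff_infComb, Pi.single_apply]
  split_ifs with h
  · rw [h, one_mul]
  · rw [zero_mul]

/-! ### Filtrations -/

theorem T_mem_filt_iff (d : Ptn → ℕ) (r : Ptn) (k : ℕ) : T r ∈ filt d k ↔ d r ≤ k := by
  classical
  constructor
  · rintro ⟨-, x, hx, hd⟩
    -- At `full r` the term of index |r| of `T r` has coefficient 1, whereas `x r = 0` would give 0.
    refine hd r fun h0 => ?_
    have h := congrArg (fun a : Seq => coeff (a r.1) (full r)) hx
    simp only [coeff_T, coeff_infComb, cosetPtn_full, h0] at h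
    simp at h
  · intro h
    refine ⟨T_mem_AInfty r, _, T_eq_infComb r, fun s hs => ?_⟩
    rw [Pi.single_apply] at hs
    split_ifs at hs with hsr
    · exact hsr ▸ h
    · exact absurd rfl hs

theorem filt_mono (d : Ptn → ℕ) : Monotone (filt d) := by
  rintro j k hjk a ⟨ha, x, hx, hd⟩
  exact ⟨ha, x, hx, fun r hr => (hd r hr).trans hjk⟩

/-- The coefficient of `T r` in the product is a sum of weights of triples whose composition is
`full r`. If it is nonzero, some weight is nonzero, so `r` is the coset-type of a composition of
extensions of two factors whose coset-types occur in `a` and `b`. -/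
theorem filt_mul_mem {d : Ptn → ℕ}
    (hd : ∀ (n : ℕ) (α₁ α₂ : PBij n) (p : Composable n), p ∈ E α₁ α₂ →
      d (cosetPtn (comp p)) ≤ d (cosetPtn α₁) + d (cosetPtn α₂))
    {j k : ℕ} {a b : Seq} (ha : a ∈ filt d j) (hb : b ∈ filt d k) : a * b ∈ filt d (j + k) := by
  obtain ⟨ha, x, rfl, hx⟩ := ha
  obtain ⟨hb, y, rfl, hy⟩ := hb
  have hab := mul_mem_AInfty ha hb
  refine ⟨hab, _, eq_infComb hab, fun r hr => ?_⟩
  rw [Pi.mul_apply, coeff_mul] at hr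
  obtain ⟨t, -, ht⟩ := Finset.exists_ne_zero_of_sum_ne_zero hr
  obtain ⟨hE, hc, h1, h2⟩ := weight_ne_zero ht
  rw [coeff_infComb] at h1 h2
  have h := hd _ _ _ _ hE
  rw [hc, cosetPtn_full] at h
  exact h.trans (add_le_add (hx _ (left_ne_zero_of_mul h1)) (hy _ (left_ne_zero_of_mul h2)))

theorem definesFiltration {d : Ptn → ℕ}
    (hd : ∀ (n : ℕ) (α₁ α₂ : PBij n) (p : Composable n), p ∈ E α₁ α₂ →
      d (cosetPtn (comp p)) ≤ d (cosetPtn α₁) + d (cosetPtn α₂)) : DefinesFiltration d where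
  mono := filt_mono d
  mul_mem _ _ _ _ := filt_mul_mem hd
  T_mem_iff := T_mem_filt_iff d
  exhaustive a ha := by
    induction ha using Submodule.span_induction with
    | mem a h =>
      obtain ⟨r, rfl⟩ := h
      exact ⟨d r, (T_mem_filt_iff d r _).2 le_rfl⟩
    | zero => exact ⟨0, zero_mem _⟩
    | add a b _ _ ha hb =>
      obtain ⟨j, hj⟩ := ha
      obtain ⟨k, hk⟩ := hb
      exact ⟨max j k, add_mem (filt_mono d (le_max_left j k) hj)
        (filt_mono d (le_max_right j k) hk)⟩
    | smul c a _ ha =>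
      obtain ⟨k, hk⟩ := ha
      exact ⟨k, (filt d k).smul_mem c hk⟩

end Limit

end HeckeFiltration

end

/-! ### Closure under the product and the three filtrations -/

theorem mainTheorem5 :
    (∀ a ∈ HeckeFiltration.AInfty, ∀ b ∈ HeckeFiltration.AInfty, a * b ∈ HeckeFiltration.AInfty) ∧
      HeckeFiltration.DefinesFiltration HeckeFiltration.deg₁ ∧
      HeckeFiltration.DefinesFiltration HeckeFiltration.deg₂ ∧
      HeckeFiltration.DefinesFiltration HeckeFiltration.deg₃ := by
  refine ⟨fun a ha b hb => HeckeFiltration.mul_mem_AInfty ha hb,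
    HeckeFiltration.definesFiltration fun n α₁ α₂ p hp =>
      HeckeFiltration.PBij.cosetType_sum_comp_le hp,
    HeckeFiltration.definesFiltration fun n α₁ α₂ p hp => ?_,
    HeckeFiltration.definesFiltration fun n α₁ α₂ p hp => ?_⟩
  all_goals obtain ⟨s, h1, h2⟩ := HeckeFiltration.PBij.exists_degree_correction hp
  · exact (Nat.le_add_right _ s).trans h1
  -- The parts 1 exceed those of the factors by at most `s`, and `|ρ| - l(ρ)` is smaller than the
  -- sum for the factors by at least `s`.
  · simp only [HeckeFiltration.deg₃, HeckeFiltration.cosetPtn]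
    omega
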